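/- **Setting.** In an $m$-message protocol in the shuffle model, with $n$ users holding $x_1,\dots,x_n\in[0,1]$, user $i$ computes $(y_i^{(1)},\dots,y_i^{(m)})=\mathcal R(x_i)$ with a local randomizer $\mathcal R$, independently of the other users. For each $j$ the messages $y^{(j)}_1,\dots,y^{(j)}_n$ are permuted by a uniformly random permutation, independently for each $j$. The $m$ resulting tuples form the *view* $\mathcal V(x)$, and an analyzer computes the output $\mathcal M(x)\in\mathbb R$ from it. The protocol is $(\epsilon,\delta)$-DP if $\Pr[\mathcal V(x)\in E]-e^{\epsilon}\Pr[\mathcal V(x')\in E]\le\delta$ for every event $E$ and all $x,x'\in[0,1]^n$ that differ in a single coordinate. Its mean squared error is $\mathrm{MSE}=\sup_{x\in[0,1]^n}\mathbb E\big[(\mathcal M(x)-\sum_i x_i)^2\big]$. **The recursive protocol** $\mathcal P^{\mathrm{rec}}_{\vec\gamma,\vec p,n}$ has precisions $p_1,\dots,p_m\in\mathbb N$ and probabilities $\gamma_1,\dots,\gamma_m\in[0,1]$. Put $q_j=\prod_{l\le j}p_l$ for $j\ge1$ and $q_0=0$; put $\bar p_j=p_j$ for $j<m$ and $\bar p_m=p_m+1$.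 On input $x$ the local randomizer computes $s_j=\lfloor q_jx-p_j\lfloor q_{j-1}x\rfloor\rfloor$ for $1\le j\le m$ and adds to $s_m$ a $\mathrm{Ber}(q_mx-p_m\lfloor q_{m-1}x\rfloor-s_m)$ random variable. Then, independently for each $j$, it sends as $j$-th message $s_j$ with probability $1-\gamma_j$, and a uniform element of $\{0,\dots,\bar p_j\}$ with probability $\gamma_j$. The analyzer outputs $\sum_{j=1}^m z_j/q_j$, where $z_j=\big(\sum_i y^{(j)}_i-n\gamma_j\bar p_j/2\big)/(1-\gamma_j)$. **Statement.** There are absolute constants $a,b>0$, and for every $\delta\in(0,1)$ there are constants $K,C>0$ that depend only on $\delta$, such that the following holds. Let $n$ be a positive integer for which $m=\lfloor\log_3\log_2 n\rfloor\ge1$, let $p_j=2^{3^j}$ for $1\le j\le m$, and let $\epsilon>0$ satisfy $\epsilon\le m$, $\log(1/\delta)\ge2\epsilon$ and $$\epsilon^2 n\ \ge\ K\,m\,2^{3^m}.$$ Then there are $\epsilon_1,\dots,\epsilon_m$ with $$a\,\frac{\epsilon}{\sqrt{m\log(1/\delta)}}\le\epsilon_j\le b\,\frac{\epsilon}{\sqrt{m\log(1/\delta)}}$$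 and $\delta_1,\dots,\delta_m\in(0,\delta]$ such that the numbers $\gamma_j=\dfrac{14\,\bar p_j\log(2/\delta_j)}{(n-1)\epsilon_j^2}$ lie in $[0,1)$, the protocol $\mathcal P^{\mathrm{rec}}_{\vec\gamma,\vec p,n}$ is $(\epsilon,\delta)$-DP, and $$\mathrm{MSE}\big(\mathcal P^{\mathrm{rec}}_{\vec\gamma,\vec p,n}\big)\le C\,\frac{(\log\log n)^2}{\epsilon^2}.$$ -/

import Mathlib

noncomputable section

namespace ShuffleModel

/-! ## Finite probability -/

/-- A coin which shows `true` with probability `t`. -/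
def coin (t : unitInterval) : PMF Bool :=
  PMF.ofFintype
    (fun b => cond b (ENNReal.ofReal (t : ℝ)) (ENNReal.ofReal (1 - (t : ℝ))))
    (by
      have h0 := t.2.1
      have h1 := t.2.2
      rw [Fintype.sum_bool]
      simp only [cond_true, cond_false]
      rw [← ENNReal.ofReal_add h0 (by linarith)]
      simp)

/-- The joint law of independent random variables with laws `P i`, `i ∈ ι`. -/
def indep {ι : Type*} [Fintype ι] [DecidableEq ι] {α : ι → Type*} [∀ i, Fintype (α i)]
    (P : ∀ i, PMF (α i)) : PMF (∀ i, α i) :=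
  PMF.ofFintype (fun y => ∏ i, P i (y i))
    (by
      have h : ∀ i, ∑ a, P i a = 1 := fun i => by
        rw [← tsum_fintype (L := .unconditional _)]
        exact (P i).tsum_coe
      rw [← Fintype.prod_sum fun i a => P i a]
      simp [h])

/-! ## The shuffle model with `m` parallel shufflers -/

/-- An `m`-message protocol for `n` users with inputs in `X`, whose `j`-th messages lie in the
finite set `Y j`, and whose output lies in `O`.  The analyzer receives, for each shuffler `j`,
the tuple of the `n` messages that this shuffler returns. -/
structure Protocol (m n : ℕ) (X : Type*) (Y : Fin m → Type*) (O : Type*) where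
  randomizer : X → PMF (∀ j, Y j)
  analyzer : (∀ j, Fin n → Y j) → O

namespace Protocol

variable {m n : ℕ} {X : Type*} {Y : Fin m → Type*} {O : Type*} [∀ j, Fintype (Y j)]

/-- The view of the data collector: each user `i` independently applies the local randomizer
to `x i`, and then the `j`-th messages of all the users are permuted by a uniformly random
permutation, independently for each `j`. -/
def view (P : Protocol m n X Y O) (x : Fin n → X) : PMF (∀ j, Fin n → Y j) :=
  (indep fun i => P.randomizer (x i)).bind fun y =>
    (indep fun _ : Fin m => PMF.uniformOfFintype (Equiv.Perm (Fin n))).map fun σ =>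
      fun j i => y (σ j i) j

/-- The randomized mechanism that the protocol defines. -/
def mechanism (P : Protocol m n X Y O) (x : Fin n → X) : PMF O :=
  (P.view x).map P.analyzer

/-- `(ε, δ)`-differential privacy of the view of the data collector, for all pairs of inputs that
differ in (at most) one coordinate. -/
def IsDP (P : Protocol m n X Y O) (ε δ : ℝ) : Prop :=
  ∀ x x' : Fin n → X, (∃ i, ∀ k, k ≠ i → x k = x' k) →
    ∀ E : Set (∀ j, Fin n → Y j),
      ((P.view x).toOuterMeasure E).toReal
        - Real.exp ε * ((P.view x').toOuterMeasure E).toReal ≤ δ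

/-- The worst-case mean squared error of a protocol for the summation of inputs in `[0,1]`. -/
def mse (P : Protocol m n (Set.Icc (0 : ℝ) 1) Y ℝ) : ENNReal :=
  ⨆ x : Fin n → Set.Icc (0 : ℝ) 1,
    ∑' z : ℝ, P.mechanism x z * ENNReal.ofReal ((z - ∑ i, (x i : ℝ)) ^ 2)

end Protocol

/-! ## The single-message building block on `{0, …, k}` -/

/-- Randomized response on `{0, …, k}`: the true value with probability `1 - γ`, a uniform one
with probability `γ`. -/
def randomizedResponse (γ : unitInterval) (k : ℕ) (x : Fin (k + 1)) : PMF (Fin (k + 1)) :=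
  (coin γ).bind fun b =>
    match b with
    | false => PMF.pure x
    | true => PMF.uniformOfFintype (Fin (k + 1))

/-- Sum of the messages, debiased; `k / 2` is the mean of the uniform law on `{0, …, k}`. -/
def debiasedSum (γ : ℝ) (k n : ℕ) (y : Fin n → Fin (k + 1)) : ℝ :=
  ((∑ i, ((y i : ℕ) : ℝ)) - n * γ * k / 2) / (1 - γ)

/-! ## The recursive protocol

Messages are indexed by `j : Fin m`, so that `j` stands for the message number `j + 1`, and `⊤`
for the last message. -/

section Recursive

variable {m : ℕ}

/-- `q p k = p_1 ⋯ p_k` for `k ≥ 1`, with the convention `q_0 = 0`. -/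
def q (p : Fin m → ℕ) (k : ℕ) : ℕ :=
  if k = 0 then 0 else ∏ l : Fin m with l.val < k, p l

/-- The real number `q_j x - p_j ⌊q_{j-1} x⌋` of which `s_j` is the integral part. -/
def residual (p : Fin m → ℕ) (x : ℝ) (j : Fin m) : ℝ :=
  (q p (j + 1) : ℝ) * x - (p j : ℝ) * (⌊(q p j : ℝ) * x⌋ : ℝ)

theorem q_succ (p : Fin m → ℕ) (j : Fin m) (hj : j.val ≠ 0) :
    q p (j + 1) = p j * q p j := by
  have h : (Finset.univ.filter fun l : Fin m => l.val < j.val + 1)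
      = insert j (Finset.univ.filter fun l : Fin m => l.val < j.val) := by
    ext l
    simp only [Finset.mem_filter, Finset.mem_univ, true_and, Finset.mem_insert, Fin.ext_iff]
    omega
  rw [q, q, if_neg (Nat.succ_ne_zero _), if_neg hj, h, Finset.prod_insert (by simp)]

theorem q_one (p : Fin m → ℕ) (j : Fin m) (hj : j.val = 0) : q p (j + 1) = p j := by
  have h : (Finset.univ.filter fun l : Fin m => l.val < j.val + 1) = {j} := by
    ext l
    simp only [Finset.mem_filter, Finset.mem_univ, true_and, Finset.mem_singleton, Fin.ext_iff]
    omega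
  rw [q, if_neg (Nat.succ_ne_zero _), h, Finset.prod_singleton]

theorem residual_mem (p : Fin m → ℕ) (x : ℝ) (hx : x ∈ Set.Icc (0 : ℝ) 1) (j : Fin m) :
    residual p x j ∈ Set.Icc (0 : ℝ) (p j) := by
  have hp : (0 : ℝ) ≤ p j := Nat.cast_nonneg _
  by_cases hj : j.val = 0
  · have h0 : q p j = 0 := by simp [q, hj]
    rw [residual, q_one p j hj, h0]
    simp only [Nat.cast_zero, zero_mul, Int.floor_zero, Int.cast_zero, mul_zero, sub_zero]
    exact ⟨mul_nonneg hp hx.1, mul_le_of_le_one_right hp hx.2⟩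
  · have e : residual p x j = (p j : ℝ) * Int.fract ((q p j : ℝ) * x) := by
      rw [residual, q_succ p j hj, Int.fract]
      push_cast
      ring
    rw [e]
    exact ⟨mul_nonneg hp (Int.fract_nonneg _),
      mul_le_of_le_one_right hp (Int.fract_lt_one _).le⟩

/-- The digit `s_j = ⌊q_j x - p_j ⌊q_{j-1} x⌋⌋`, before the rounding of the last one. -/
def digit (p : Fin m → ℕ) (x : ℝ) (j : Fin m) : ℕ := ⌊residual p x j⌋₊

theorem digit_le (p : Fin m → ℕ) (x : ℝ) (hx : x ∈ Set.Icc (0 : ℝ) 1) (j : Fin m) :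
    digit p x j ≤ p j :=
  Nat.floor_le_of_le (residual_mem p x hx j).2

variable [NeZero m]

/-- The precision used for message `j`: `p_j` for `j < m`, and `p_m + 1` for the last one. -/
def precision (p : Fin m → ℕ) (j : Fin m) : ℕ := p j + if j = ⊤ then 1 else 0

/-- The probability that the last digit is rounded up: `q_m x - p_m ⌊q_{m-1} x⌋ - s_m`. -/
def roundUpProb (p : Fin m → ℕ) (x : Set.Icc (0 : ℝ) 1) : unitInterval :=
  ⟨residual p x ⊤ - (digit p x ⊤ : ℝ),
    sub_nonneg.2 (Nat.floor_le (residual_mem p x x.2 ⊤).1),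
    by
      have h := Nat.lt_floor_add_one (residual p (x : ℝ) ⊤)
      simp only [digit]
      linarith⟩

/-- The digits `s_1, …, s_m`, where the last one is increased by one if `r` is `true`. -/
def encoding (p : Fin m → ℕ) (x : Set.Icc (0 : ℝ) 1) (r : Bool) (j : Fin m) :
    Fin (precision p j + 1) :=
  ⟨digit p x j + if j = ⊤ then (if r = true then 1 else 0) else 0, by
    have h := digit_le p x x.2 j
    unfold precision
    split_ifs <;> omega⟩

/-- The recursive protocol with precisions `p_j` and randomized response probabilities `γ_j`. -/
def recursiveProtocol (n : ℕ) (p : Fin m → ℕ) (γ : Fin m → unitInterval) :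
    Protocol m n (Set.Icc (0 : ℝ) 1) (fun j => Fin (precision p j + 1)) ℝ where
  randomizer x :=
    (coin (roundUpProb p x)).bind fun r =>
      indep fun j => randomizedResponse (γ j) (precision p j) (encoding p x r j)
  analyzer y :=
    ∑ j : Fin m, debiasedSum (γ j) (precision p j) n (y j) / (q p (j + 1) : ℝ)

end Recursive

end ShuffleModel

end

/-! Privacy is proved in total variation, with the factor $e^\epsilon$ bounded below by $1$. All
$\epsilon_j$ equal $\epsilon/\sqrt{m\log(1/\delta)}$, and all $\delta_j$ equal one number so small,
in terms of $\delta$ alone, that the noise hides a user up to $\delta$; the constants $K$ and $C$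
absorb the cost.

Fix a user $i_0$ and condition on the random roundings. The view is then a product over the
shufflers (`expect_view`). It is compared with the reference view in which $i_0$ sends uniform
messages. Writing $k_j=\bar p_j$, the users who sent uniform $j$-th messages form, together with
$i_0$, a blanket $B$; a shuffler cannot tell its members apart, so the density of the message of
$i_0$ may be averaged over $B$ (`sum_response_eq_sum_blanketDensity`). The average has second moment
at most $1+k_j\,\mathbb E[1/|B|]\le 1+k_j/(n\gamma_j)$. These factors multiply over $j$, and
Cauchy–Schwarz bounds the squared distance to the reference by $\exp(\sum_j k_j/(n\gamma_j))-1$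
(`sq_sum_pi_prod_sub_le`). The averaged reference does not depend on $x_{i_0}$, so the triangle
inequality gives `recursiveProtocol_isDP`.

For the error, the digits telescope and the last rounding is unbiased, so the output is a sum of
independent unbiased terms, one per user (`recursiveProtocol_mse_le`). Level $j$ contributes
variance of order $n\gamma_j k_j^2/q_j^2$, and $\gamma_j$ is proportional to $k_j$. The choice
$p_j=2^{3^j}$ gives $8q_j^2=p_j^3$ (`eight_mul_sq_q`), so every level costs $O(m/\epsilon^2)$ and
all of them $O(m^2/\epsilon^2)$. Rounding costs at most $n/q_m^2\le 8$, and $m\le 2\log\log n$. -/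

namespace ShuffleModel

open Finset

/-! ### Product weights: moments, change of one coordinate, chi-square bound. -/

section WeightedSums

variable {ι : Type*} [Fintype ι] [DecidableEq ι] {α β : ι → Type*} [∀ i, Fintype (α i)]
  [∀ i, Fintype (β i)]

theorem sum_pi_prod_eq_one (w : ∀ i, α i → ℝ) (hw : ∀ i, ∑ a, w i a = 1) :
    ∑ y : ∀ i, α i, ∏ i, w i (y i) = 1 := by
  rw [← Fintype.prod_sum]
  simp [hw]

/-- The image of a product of weights under a product of maps. -/
theorem sum_pi_prod_push [∀ i, DecidableEq (β i)] (w : ∀ i, α i → ℝ) (g : ∀ i, α i → β i)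
    (f : (∀ i, β i) → ℝ) :
    ∑ z : ∀ i, β i, (∏ i, ∑ a, w i a * (if g i a = z i then 1 else 0)) * f z
      = ∑ y : ∀ i, α i, (∏ i, w i (y i)) * f (fun i => g i (y i)) := by
  simp_rw [Fintype.prod_sum, sum_mul]
  rw [sum_comm]
  refine sum_congr rfl fun y _ => ?_
  rw [sum_eq_single (fun i => g i (y i))]
  · simp
  · intro z _ hz
    obtain ⟨i, hi⟩ : ∃ i, g i (y i) ≠ z i := by
      by_contra h
      push Not at h
      exact hz (funext fun i => (h i).symm)
    rw [prod_eq_zero (mem_univ i) (by simp [hi]), zero_mul]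
  · simp

theorem sum_pi_prod_mul_apply_mul_apply (w : ∀ i, α i → ℝ) (hw : ∀ i, ∑ a, w i a = 1)
    (f : ∀ i, α i → ℝ) (p r : ι) :
    ∑ y : ∀ i, α i, (∏ i, w i (y i)) * (f p (y p) * f r (y r))
      = if p = r then ∑ a, w p a * f p a ^ 2
        else (∑ a, w p a * f p a) * ∑ a, w r a * f r a := by
  have h : ∀ y : ∀ i, α i, (∏ i, w i (y i)) * (f p (y p) * f r (y r))
      = ∏ i, w i (y i) * ((if i = p then f i (y i) else 1) * if i = r then f i (y i) else 1) := by
    intro y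
    rw [prod_mul_distrib, prod_mul_distrib, prod_ite_eq' univ p, prod_ite_eq' univ r]
    simp
  simp_rw [h]
  rw [← Fintype.prod_sum fun i a =>
    w i a * ((if i = p then f i a else 1) * if i = r then f i a else 1)]
  split_ifs with hpr
  · subst hpr
    rw [prod_eq_single p]
    · simp [sq]
    · intro i _ hi
      simp [hi, hw]
    · simp
  · rw [← mul_prod_erase univ _ (mem_univ p),
      ← mul_prod_erase _ _ (mem_erase.2 ⟨Ne.symm hpr, mem_univ r⟩), prod_eq_one]
    · simp [hpr, Ne.symm hpr]
    · intro i hi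
      simp only [mem_erase] at hi
      simp [hi.1, hi.2.1, hw]

theorem sum_pi_prod_mul_apply (w : ∀ i, α i → ℝ) (hw : ∀ i, ∑ a, w i a = 1)
    (f : ∀ i, α i → ℝ) (p : ι) :
    ∑ y : ∀ i, α i, (∏ i, w i (y i)) * f p (y p) = ∑ a, w p a * f p a := by
  have h : ∀ y : ∀ i, α i, (∏ i, w i (y i)) * f p (y p)
      = ∏ i, w i (y i) * (if i = p then f i (y i) else 1) := by
    intro y
    rw [prod_mul_distrib, prod_ite_eq' univ p]
    simp
  simp_rw [h]
  rw [← Fintype.prod_sum fun i a => w i a * (if i = p then f i a else 1), prod_eq_single p]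
  · simp
  · intro i _ hi
    simp [hi, hw]
  · simp

/-- The mean squared deviation of a sum of independent terms from a constant. -/
theorem sum_pi_prod_mul_sum_sub_sq (w : ∀ i, α i → ℝ) (hw : ∀ i, ∑ a, w i a = 1)
    (f : ∀ i, α i → ℝ) (c : ℝ) :
    ∑ y : ∀ i, α i, (∏ i, w i (y i)) * (∑ i, f i (y i) - c) ^ 2
      = (∑ i, ∑ a, w i a * f i a - c) ^ 2
        + ∑ i, (∑ a, w i a * f i a ^ 2 - (∑ a, w i a * f i a) ^ 2) := by
  have h : ∀ y : ∀ i, α i, (∏ i, w i (y i)) * (∑ i, f i (y i) - c) ^ 2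
      = ∑ p, ∑ r, (∏ i, w i (y i)) * (f p (y p) * f r (y r))
        - 2 * c * ∑ p, (∏ i, w i (y i)) * f p (y p) + c ^ 2 * ∏ i, w i (y i) := by
    intro y
    simp_rw [← mul_sum, ← sum_mul]
    ring
  have h1 : ∀ p, ∑ y : ∀ i, α i, ∑ r, (∏ i, w i (y i)) * (f p (y p) * f r (y r))
      = ∑ a, w p a * f p a ^ 2 - (∑ a, w p a * f p a) ^ 2
        + (∑ a, w p a * f p a) * ∑ r, ∑ a, w r a * f r a := by
    intro p
    rw [sum_comm]
    simp_rw [sum_pi_prod_mul_apply_mul_apply w hw f p]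
    rw [← add_sum_erase univ _ (mem_univ p),
      ← add_sum_erase univ (fun r => ∑ a, w r a * f r a) (mem_univ p), if_pos rfl,
      sum_congr rfl fun r hr => if_neg (Ne.symm (ne_of_mem_erase hr)), ← mul_sum]
    ring
  have h2 : ∑ y : ∀ i, α i, ∑ p, ∑ r, (∏ i, w i (y i)) * (f p (y p) * f r (y r))
      = ∑ i, (∑ a, w i a * f i a ^ 2 - (∑ a, w i a * f i a) ^ 2)
        + (∑ i, ∑ a, w i a * f i a) ^ 2 := by
    rw [sum_comm, sum_congr rfl fun p _ => h1 p, sum_add_distrib, ← sum_mul, sq (∑ i, _)]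
  have h3 : ∑ y : ∀ i, α i, ∑ p, (∏ i, w i (y i)) * f p (y p) = ∑ i, ∑ a, w i a * f i a := by
    rw [sum_comm, sum_congr rfl fun p _ => sum_pi_prod_mul_apply w hw f p]
  rw [sum_congr rfl fun y _ => h y, sum_add_distrib, sum_sub_distrib, ← mul_sum, ← mul_sum, h2, h3,
    sum_pi_prod_eq_one w hw]
  ring

/-- A function that ignores the coordinate `i₀` does not see how that coordinate is weighted. -/
theorem sum_pi_prod_mul_of_update (i₀ : ι) (w w' : ∀ i, α i → ℝ)
    (hw : ∀ i, i ≠ i₀ → w i = w' i) (f : (∀ i, α i) → ℝ)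
    (hf : ∀ y b, f (Function.update y i₀ b) = f y) :
    (∑ y : ∀ i, α i, (∏ i, w i (y i)) * f y) * ∑ b, w' i₀ b
      = (∑ y : ∀ i, α i, (∏ i, w' i (y i)) * f y) * ∑ b, w i₀ b := by
  simp_rw [sum_mul, mul_sum]
  rw [← Fintype.sum_prod_type', ← Fintype.sum_prod_type']
  -- The involution that exchanges the coordinate at `i₀` with the extra sample; it carries one
  -- weighted sum to the other.
  let e : (∀ i, α i) × α i₀ ≃ (∀ i, α i) × α i₀ :=
    { toFun := fun z => (Function.update z.1 i₀ z.2, z.1 i₀)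
      invFun := fun z => (Function.update z.1 i₀ z.2, z.1 i₀)
      left_inv := fun z => by simp
      right_inv := fun z => by simp }
  refine Fintype.sum_equiv e _ _ fun z => ?_
  have key : ∀ i, i ∈ univ.erase i₀ → w i (z.1 i) = w' i (Function.update z.1 i₀ z.2 i) := by
    intro i hi
    rw [Function.update_of_ne (ne_of_mem_erase hi), hw i (ne_of_mem_erase hi)]
  simp only [e, Equiv.coe_fn_mk, hf]
  rw [← mul_prod_erase univ _ (mem_univ i₀), ← mul_prod_erase univ (fun i => w' i _) (mem_univ i₀),
    prod_congr rfl key]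
  simp only [Function.update_self]
  ring

end WeightedSums

/-- Chi-square bound for product laws: if the laws `P j` have the densities `A j` against `μ j`,
then an event seen through the kernels `T j` can hardly distinguish `⊗ P j` from `⊗ μ j`. -/
theorem sq_sum_pi_prod_sub_le {κ : Type*} [Fintype κ] [DecidableEq κ] {Ω V : κ → Type*}
    [∀ j, Fintype (Ω j)] [∀ j, Fintype (V j)] (μ A : ∀ j, Ω j → ℝ) (T : ∀ j, Ω j → V j → ℝ)
    (hμ : ∀ j ω, 0 ≤ μ j ω) (hμ1 : ∀ j, ∑ ω, μ j ω = 1) (hA1 : ∀ j, ∑ ω, μ j ω * A j ω = 1)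
    (t : κ → ℝ) (hA2 : ∀ j, ∑ ω, μ j ω * A j ω ^ 2 ≤ 1 + t j)
    (hT : ∀ j ω v, 0 ≤ T j ω v) (hT1 : ∀ j ω, ∑ v, T j ω v = 1)
    (f : (∀ j, V j) → ℝ) (hf0 : ∀ v, 0 ≤ f v) (hf1 : ∀ v, f v ≤ 1) :
    (∑ v : ∀ j, V j, (∏ j, ∑ ω, μ j ω * A j ω * T j ω (v j)) * f v
      - ∑ v : ∀ j, V j, (∏ j, ∑ ω, μ j ω * T j ω (v j)) * f v) ^ 2
      ≤ Real.exp (∑ j, t j) - 1 := by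
  let H : (∀ j, Ω j) → ℝ := fun ω => ∑ v : ∀ j, V j, (∏ j, T j (ω j) (v j)) * f v
  have hTn : ∀ (ω : ∀ j, Ω j) (v : ∀ j, V j), 0 ≤ ∏ j, T j (ω j) (v j) :=
    fun ω v => prod_nonneg fun j _ => hT j _ _
  have hH0 : ∀ ω, 0 ≤ H ω := fun ω => sum_nonneg fun v _ => mul_nonneg (hTn ω v) (hf0 v)
  have hH1 : ∀ ω, H ω ≤ 1 := fun ω => by
    rw [← sum_pi_prod_eq_one (fun j => T j (ω j)) fun j => hT1 j (ω j)]
    exact sum_le_sum fun v _ => mul_le_of_le_one_right (hTn ω v) (hf1 v)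
  have lift : ∀ W : ∀ j, Ω j → ℝ,
      ∑ v : ∀ j, V j, (∏ j, ∑ ω, W j ω * T j ω (v j)) * f v
        = ∑ ω : ∀ j, Ω j, (∏ j, W j (ω j)) * H ω := by
    intro W
    simp_rw [Fintype.prod_sum, sum_mul, H, mul_sum]
    rw [sum_comm]
    refine sum_congr rfl fun ω _ => sum_congr rfl fun v _ => ?_
    rw [prod_mul_distrib]
    ring
  rw [lift fun j ω => μ j ω * A j ω, lift μ, ← sum_sub_distrib]
  have hμn : ∀ ω : ∀ j, Ω j, 0 ≤ ∏ j, μ j (ω j) := fun ω => prod_nonneg fun j _ => hμ j _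
  have e : ∀ ω : ∀ j, Ω j, (∏ j, μ j (ω j) * A j (ω j)) * H ω - (∏ j, μ j (ω j)) * H ω
      = (∏ j, μ j (ω j)) * ((∏ j, A j (ω j) - 1) * H ω) := by
    intro ω
    rw [prod_mul_distrib]
    ring
  -- Cauchy–Schwarz against the probability weight `∏ j, μ j`; what remains is the chi-square
  -- divergence of the product, since `0 ≤ H ≤ 1`.
  have cs : (∑ ω : ∀ j, Ω j, (∏ j, μ j (ω j)) * ((∏ j, A j (ω j) - 1) * H ω)) ^ 2
      ≤ (∑ ω : ∀ j, Ω j, ∏ j, μ j (ω j))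
        * ∑ ω : ∀ j, Ω j, (∏ j, μ j (ω j)) * ((∏ j, A j (ω j) - 1) * H ω) ^ 2 := by
    refine sum_sq_le_sum_mul_sum_of_sq_le_mul _ (fun ω _ => hμn ω)
      (fun ω _ => mul_nonneg (hμn ω) (sq_nonneg _)) fun ω _ => le_of_eq ?_
    ring
  rw [sum_congr rfl fun ω _ => e ω]
  refine cs.trans ?_
  rw [sum_pi_prod_eq_one μ hμ1, one_mul]
  calc ∑ ω : ∀ j, Ω j, (∏ j, μ j (ω j)) * ((∏ j, A j (ω j) - 1) * H ω) ^ 2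
      ≤ ∑ ω : ∀ j, Ω j, (∏ j, μ j (ω j)) * (∏ j, A j (ω j) - 1) ^ 2 := by
        refine sum_le_sum fun ω _ => mul_le_mul_of_nonneg_left ?_ (hμn ω)
        rw [mul_pow]
        exact mul_le_of_le_one_right (sq_nonneg _) (pow_le_one₀ (hH0 ω) (hH1 ω))
    _ = ∑ ω : ∀ j, Ω j, ∏ j, μ j (ω j) * A j (ω j) ^ 2
        - 2 * ∑ ω : ∀ j, Ω j, ∏ j, μ j (ω j) * A j (ω j)
        + ∑ ω : ∀ j, Ω j, ∏ j, μ j (ω j) := by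
        rw [mul_sum, ← sum_sub_distrib, ← sum_add_distrib]
        refine sum_congr rfl fun ω _ => ?_
        rw [prod_mul_distrib, prod_mul_distrib, prod_pow]
        ring
    _ = ∏ j, ∑ ω, μ j ω * A j ω ^ 2 - 1 := by
        rw [sum_pi_prod_eq_one μ hμ1, sum_pi_prod_eq_one (fun j ω => μ j ω * A j ω) hA1,
          ← Fintype.prod_sum fun j ω => μ j ω * A j ω ^ 2]
        ring
    _ ≤ Real.exp (∑ j, t j) - 1 := by
        rw [Real.exp_sum]
        refine sub_le_sub_right (prod_le_prod (fun j _ => ?_) fun j _ => ?_) 1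
        · exact sum_nonneg fun ω _ => mul_nonneg (hμ j ω) (sq_nonneg _)
        · linarith [hA2 j, Real.add_one_le_exp (t j)]

end ShuffleModel

namespace ShuffleModel

open Finset

noncomputable section

/-! ### The privacy blanket of one shuffler. -/

section Blanket

variable {ι : Type*} [Fintype ι]

/-- The real number that `coin` attaches to `b`. -/
def coinWeight (t : ℝ) (b : Bool) : ℝ := cond b t (1 - t)

theorem coinWeight_nonneg {t : ℝ} (h0 : 0 ≤ t) (h1 : t ≤ 1) (b : Bool) : 0 ≤ coinWeight t b := by
  cases b <;> simp [coinWeight, h0, h1]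

theorem sum_coinWeight (t : ℝ) : ∑ b, coinWeight t b = 1 := by
  simp [coinWeight]

/-- The probability that randomized response turns `x` into `y`. -/
def responseWeight (γ : ℝ) (k : ℕ) (x y : Fin (k + 1)) : ℝ :=
  (1 - γ) * (if y = x then 1 else 0) + γ * ((k : ℝ) + 1)⁻¹

theorem sum_responseWeight (γ : ℝ) (k : ℕ) (x : Fin (k + 1)) :
    ∑ y, responseWeight γ k x y = 1 := by
  have : (k : ℝ) + 1 ≠ 0 := by positivity
  simp only [responseWeight, sum_add_distrib, ← mul_sum, sum_ite_eq', mem_univ, if_true, sum_const,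
    card_univ, Fintype.card_fin, nsmul_eq_mul]
  push_cast
  field_simp
  ring

/-- The density of randomized response on input `x` with respect to the uniform law. -/
def responseDensity (γ : ℝ) (k : ℕ) (x y : Fin (k + 1)) : ℝ :=
  γ + (1 - γ) * ((k + 1) * if y = x then 1 else 0)

theorem responseDensity_eq (γ : ℝ) (k : ℕ) (x y : Fin (k + 1)) :
    ((k : ℝ) + 1)⁻¹ * responseDensity γ k x y = responseWeight γ k x y := by
  have : (k : ℝ) + 1 ≠ 0 := by positivity
  unfold responseWeight responseDensity
  field_simp
  ring

theorem sum_responseDensity (γ : ℝ) (k : ℕ) (x : Fin (k + 1)) :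
    ∑ y, ((k : ℝ) + 1)⁻¹ * responseDensity γ k x y = 1 := by
  simp_rw [responseDensity_eq]
  exact sum_responseWeight γ k x

/-- The left side equals $1+(1-\gamma)^2k$: one randomized response has chi-square divergence at
most $k$ from uniform. -/
theorem sum_responseDensity_sq_le {γ : ℝ} (h0 : 0 ≤ γ) (h1 : γ ≤ 1) (k : ℕ) (x : Fin (k + 1)) :
    ∑ y, ((k : ℝ) + 1)⁻¹ * responseDensity γ k x y ^ 2 ≤ 1 + k := by
  have hk : (k : ℝ) + 1 ≠ 0 := by positivity
  have h : ∀ y, ((k : ℝ) + 1)⁻¹ * responseDensity γ k x y ^ 2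
      = ((k : ℝ) + 1)⁻¹ * γ ^ 2
        + (2 * γ * (1 - γ) + (1 - γ) ^ 2 * (k + 1)) * if y = x then 1 else 0 := by
    intro y
    unfold responseDensity
    split_ifs <;> field_simp <;> ring
  simp_rw [h]
  simp only [sum_add_distrib, ← mul_sum, sum_ite_eq', mem_univ, if_true, sum_const,
    card_univ, Fintype.card_fin, nsmul_eq_mul]
  push_cast
  rw [inv_mul_cancel_left₀ hk]
  have : (1 - γ) ^ 2 * (k : ℝ) ≤ 1 * k :=
    mul_le_mul_of_nonneg_right (by nlinarith) (Nat.cast_nonneg k)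
  nlinarith

/-- The weight of the bits `ω.1` and the uniform samples `ω.2`. -/
def blanketWeight (γ : ℝ) (k : ℕ) (ω : (ι → Bool) × (ι → Fin (k + 1))) : ℝ :=
  (∏ i, coinWeight γ (ω.1 i)) * ∏ _i : ι, ((k : ℝ) + 1)⁻¹

theorem blanketWeight_nonneg {γ : ℝ} (h0 : 0 ≤ γ) (h1 : γ ≤ 1) (k : ℕ)
    (ω : (ι → Bool) × (ι → Fin (k + 1))) : 0 ≤ blanketWeight γ k ω :=
  mul_nonneg (prod_nonneg fun i _ => coinWeight_nonneg h0 h1 _) (prod_nonneg fun i _ => by positivity)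

variable [DecidableEq ι]

/-- The users whose messages are uniform, for the bits `β`, and the user `i₀`. -/
def blanket (i₀ : ι) (β : ι → Bool) : Finset ι := univ.filter fun i => i = i₀ ∨ β i = true

theorem self_mem_blanket (i₀ : ι) (β : ι → Bool) : i₀ ∈ blanket i₀ β := by simp [blanket]

theorem blanket_card_pos (i₀ : ι) (β : ι → Bool) : 0 < ((blanket i₀ β).card : ℝ) :=
  Nat.cast_pos.2 (card_pos.2 ⟨i₀, self_mem_blanket i₀ β⟩)

/-- The messages for the bits `ω.1` and the uniform samples `ω.2`. -/
def blanketMessages {k : ℕ} (i₀ : ι) (s : ι → Fin (k + 1)) (ω : (ι → Bool) × (ι → Fin (k + 1)))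
    (i : ι) : Fin (k + 1) :=
  if i = i₀ ∨ ω.1 i = true then ω.2 i else s i

/-- The density of the law of user `i₀`, averaged over the blanket. -/
def blanketDensity (γ : ℝ) {k : ℕ} (i₀ : ι) (x : Fin (k + 1))
    (ω : (ι → Bool) × (ι → Fin (k + 1))) : ℝ :=
  ((blanket i₀ ω.1).card : ℝ)⁻¹ * ∑ i ∈ blanket i₀ ω.1, responseDensity γ k x (ω.2 i)

theorem sum_uniform (k : ℕ) : ∑ _a : Fin (k + 1), ((k : ℝ) + 1)⁻¹ = 1 := by
  have : (k : ℝ) + 1 ≠ 0 := by positivity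
  simp [this]

theorem sum_blanketWeight (γ : ℝ) (k : ℕ) :
    ∑ ω : (ι → Bool) × (ι → Fin (k + 1)), blanketWeight γ k ω = 1 := by
  simp only [blanketWeight, Fintype.sum_prod_type, ← mul_sum]
  rw [sum_pi_prod_eq_one (fun (_ : ι) (_ : Fin (k + 1)) => ((k : ℝ) + 1)⁻¹) fun _ => sum_uniform k]
  simp only [mul_one]
  exact sum_pi_prod_eq_one (fun (_ : ι) b => coinWeight γ b) fun _ => sum_coinWeight γ

/-- Randomized responses, written with bits and uniform samples. -/
theorem sum_response_eq_sum_blanket (γ : ℝ) {k : ℕ} (i₀ : ι) (s : ι → Fin (k + 1))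
    (Φ : (ι → Fin (k + 1)) → ℝ) :
    ∑ y : ι → Fin (k + 1), (∏ i, responseWeight γ k (s i) (y i)) * Φ y
      = ∑ ω, blanketWeight γ k ω * responseDensity γ k (s i₀) (ω.2 i₀)
          * Φ (blanketMessages i₀ s ω) := by
  -- Each user draws a bit and a uniform sample. User `i₀` always sends the sample, reweighted by
  -- its density; its bit is drawn but has no effect.
  let w : ι → Bool × Fin (k + 1) → ℝ := fun i c =>
    coinWeight γ c.1 * ((k : ℝ) + 1)⁻¹ * if i = i₀ then responseDensity γ k (s i) c.2 else 1
  let g : ι → Bool × Fin (k + 1) → Fin (k + 1) := fun i c =>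
    if i = i₀ ∨ c.1 = true then c.2 else s i
  have hwg : ∀ i z, ∑ c, w i c * (if g i c = z then 1 else 0) = responseWeight γ k (s i) z := by
    intro i z
    rw [Fintype.sum_prod_type, Fintype.sum_bool]
    by_cases hi : i = i₀
    · simp only [w, g, hi, true_or, if_true, mul_ite, mul_one, mul_zero, sum_ite_eq', mem_univ,
        mul_assoc, responseDensity_eq, ← add_mul, coinWeight, cond_true, cond_false]
      ring
    · simp only [w, g, hi, false_or, if_true, if_false, mul_ite, mul_one, mul_zero, sum_ite_eq',
        mem_univ, Bool.false_eq_true, coinWeight, cond_true, cond_false]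
      split_ifs with h1
      · rw [← mul_sum, sum_uniform, responseWeight, if_pos h1.symm]
        ring
      · rw [sum_const_zero, responseWeight, if_neg (Ne.symm h1)]
        ring
  have h := sum_pi_prod_push w g Φ
  simp_rw [hwg] at h
  rw [h]
  refine Fintype.sum_equiv (Equiv.arrowProdEquivProdArrow ι (fun _ => Bool) fun _ => Fin (k + 1))
    _ _ fun c => ?_
  simp only [w, g, prod_mul_distrib, prod_ite_eq', mem_univ, if_true, blanketWeight]
  rfl

/-- What does not depend on the order of the messages sees only the average over the blanket. -/
theorem sum_response_eq_sum_blanketDensity (γ : ℝ) {k : ℕ} (i₀ : ι) (s : ι → Fin (k + 1))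
    (Φ : (ι → Fin (k + 1)) → ℝ) (hΦ : ∀ y (τ : Equiv.Perm ι), Φ (y ∘ τ) = Φ y) :
    ∑ y : ι → Fin (k + 1), (∏ i, responseWeight γ k (s i) (y i)) * Φ y
      = ∑ ω, blanketWeight γ k ω * blanketDensity γ i₀ (s i₀) ω
          * Φ (blanketMessages i₀ s ω) := by
  rw [sum_response_eq_sum_blanket γ i₀, Fintype.sum_prod_type, Fintype.sum_prod_type]
  refine sum_congr rfl fun β _ => ?_
  simp only [blanketWeight, blanketDensity, mul_assoc, ← mul_sum]
  congr 2
  -- Both `i` and `i₀` send their samples, so exchanging these samples only permutes the messages,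
  -- which `Φ` does not notice.
  have swap : ∀ i ∈ blanket i₀ β,
      ∑ u : ι → Fin (k + 1), responseDensity γ k (s i₀) (u i) * Φ (blanketMessages i₀ s (β, u))
        = ∑ u : ι → Fin (k + 1),
            responseDensity γ k (s i₀) (u i₀) * Φ (blanketMessages i₀ s (β, u)) := by
    intro i hi
    refine Fintype.sum_equiv ((Equiv.swap i₀ i).arrowCongr (Equiv.refl _)) _ _ fun u => ?_
    have e : blanketMessages i₀ s (β, (Equiv.swap i₀ i).arrowCongr (Equiv.refl _) u)
        = blanketMessages i₀ s (β, u) ∘ Equiv.swap i₀ i := by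
      have hi' : i = i₀ ∨ β i = true := by simpa [blanket] using hi
      funext l
      simp only [blanketMessages, Equiv.arrowCongr_apply, Function.comp_apply, Equiv.symm_swap,
        Equiv.coe_refl, id_eq]
      rcases eq_or_ne l i₀ with rfl | h0
      · simp [hi']
      · rcases eq_or_ne l i with rfl | h1
        · simp [hi']
        · rw [Equiv.swap_apply_of_ne_of_ne h0 h1]
    rw [e, hΦ]
    simp [Equiv.arrowCongr_apply]
  have hc : ((blanket i₀ β).card : ℝ) ≠ 0 := (blanket_card_pos i₀ β).ne'
  have : ((blanket i₀ β).card : ℝ)⁻¹ * ∑ u : ι → Fin (k + 1),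
      (∑ i ∈ blanket i₀ β, responseDensity γ k (s i₀) (u i)) * Φ (blanketMessages i₀ s (β, u))
      = ∑ u : ι → Fin (k + 1),
          responseDensity γ k (s i₀) (u i₀) * Φ (blanketMessages i₀ s (β, u)) := by
    simp_rw [sum_mul]
    rw [sum_comm, sum_congr rfl swap, sum_const, nsmul_eq_mul, inv_mul_cancel_left₀ hc]
  exact this.symm

/-- The preceding identity for the test function `Φ = 1`. -/
theorem sum_blanketWeight_mul_blanketDensity (γ : ℝ) {k : ℕ} (i₀ : ι) (x : Fin (k + 1)) :
    ∑ ω : (ι → Bool) × (ι → Fin (k + 1)), blanketWeight γ k ω * blanketDensity γ i₀ x ω = 1 := by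
  have h := sum_response_eq_sum_blanketDensity γ i₀ (fun _ => x) (fun _ => 1) fun _ _ => rfl
  simp only [mul_one] at h
  rw [← h]
  exact sum_pi_prod_eq_one (fun _ => responseWeight γ k x) fun _ => sum_responseWeight γ k x

/-- The mean of the reciprocal of the size of the blanket is at most `1 / (γ n)`. -/
theorem sum_inv_card_blanket_le {γ : ℝ} (h0 : 0 ≤ γ) (h1 : γ ≤ 1) (i₀ : ι) :
    Fintype.card ι * γ * ∑ β : ι → Bool, (∏ i, coinWeight γ (β i)) * ((blanket i₀ β).card : ℝ)⁻¹
      ≤ 1 := by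
  let B : (ι → Bool) → Finset ι := fun β => univ.filter fun i => β i = true
  -- With `B` the set of true bits, `φ i` is $\mathbb E[1_{i\in B}/|B|]$. These numbers are equal by
  -- symmetry and sum to $\Pr[B\ne\emptyset]\le1$. Conditioning on the bit of `i₀` being true turns
  -- `B` into the blanket.
  let φ : ι → ℝ := fun i =>
    ∑ β : ι → Bool, (∏ l, coinWeight γ (β l)) * if β i = true then ((B β).card : ℝ)⁻¹ else 0
  have hsum : ∑ i, φ i ≤ 1 := by
    rw [← sum_pi_prod_eq_one (fun (_ : ι) b => coinWeight γ b) fun _ => sum_coinWeight γ, sum_comm]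
    refine sum_le_sum fun β _ => ?_
    rw [← mul_sum, ← sum_filter, sum_const, nsmul_eq_mul]
    exact mul_le_of_le_one_right (prod_nonneg fun i _ => coinWeight_nonneg h0 h1 _)
      (mul_inv_le_one)
  have heq : ∀ i, φ i = φ i₀ := by
    intro i
    refine Fintype.sum_equiv ((Equiv.swap i₀ i).arrowCongr (Equiv.refl _)) _ _ fun β => ?_
    have hc : (B ((Equiv.swap i₀ i).arrowCongr (Equiv.refl _) β)).card = (B β).card := by
      refine card_equiv (Equiv.swap i₀ i) fun l => ?_
      simp [B, Equiv.arrowCongr_apply]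
    have hp : ∏ l, coinWeight γ ((Equiv.swap i₀ i).arrowCongr (Equiv.refl _) β l)
        = ∏ l, coinWeight γ (β l) := by
      simp only [Equiv.arrowCongr_apply, Function.comp_apply, Equiv.symm_swap, Equiv.coe_refl, id_eq]
      exact Equiv.prod_comp (Equiv.swap i₀ i) fun l => coinWeight γ (β l)
    rw [hc, hp]
    simp [Equiv.arrowCongr_apply]
  have hφ : φ i₀ = γ * ∑ β : ι → Bool, (∏ i, coinWeight γ (β i)) * ((blanket i₀ β).card : ℝ)⁻¹ := by
    -- The restriction to a true bit at `i₀`, of total mass `γ` there. The blanket ignores this bit,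
    -- so only the mass changes.
    let w' : ι → Bool → ℝ := fun i b => coinWeight γ b * if i = i₀ ∧ b = false then 0 else 1
    have h := sum_pi_prod_mul_of_update i₀ (fun _ : ι => coinWeight γ) w'
      (fun i hi => by funext b; simp [w', hi]) (fun β => ((blanket i₀ β).card : ℝ)⁻¹)
      (fun β b => by
        have : blanket i₀ (Function.update β i₀ b) = blanket i₀ β := by
          ext l
          by_cases hl : l = i₀ <;> simp [blanket, hl]
        simp only [this])
    have hw' : ∑ b, w' i₀ b = γ := by simp [w', coinWeight]
    simp only [hw', sum_coinWeight, mul_one] at h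
    rw [mul_comm, h]
    refine sum_congr rfl fun β _ => ?_
    simp only [w', prod_mul_distrib, mul_assoc]
    congr 1
    by_cases hb : β i₀ = true
    · have hS : blanket i₀ β = B β := by
        ext l
        by_cases hl : l = i₀ <;> simp [blanket, B, hl, hb]
      rw [prod_eq_one, if_pos hb, hS, one_mul]
      intro l _
      rw [if_neg]
      rintro ⟨rfl, hf⟩
      exact Bool.false_ne_true (hf.symm.trans hb)
    · rw [if_neg hb, prod_eq_zero (mem_univ i₀) (by simp [hb]), zero_mul]
  rw [mul_assoc, ← hφ, ← nsmul_eq_mul, ← card_univ, ← sum_const, ← sum_congr rfl fun i _ => heq i]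
  exact hsum

/-- Given the bits, the density is a mean of $|B|$ independent terms of mean $1$ and variance at
most $k$, so its second moment is at most $1+k/|B|$; then $\mathbb E[1/|B|]\le1/(n\gamma)$. -/
theorem sum_blanketWeight_mul_blanketDensity_sq_le {γ : ℝ} (h0 : 0 < γ) (h1 : γ ≤ 1) {k : ℕ}
    (i₀ : ι) (x : Fin (k + 1)) :
    ∑ ω : (ι → Bool) × (ι → Fin (k + 1)), blanketWeight γ k ω * blanketDensity γ i₀ x ω ^ 2
      ≤ 1 + k / (Fintype.card ι * γ) := by
  have hn : (0 : ℝ) < Fintype.card ι := Nat.cast_pos.2 (Fintype.card_pos_iff.2 ⟨i₀⟩)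
  have inner : ∀ β : ι → Bool,
      ∑ u : ι → Fin (k + 1), (∏ _i : ι, ((k : ℝ) + 1)⁻¹) * blanketDensity γ i₀ x (β, u) ^ 2
        ≤ 1 + ((blanket i₀ β).card : ℝ)⁻¹ * k := by
    intro β
    have hc := blanket_card_pos i₀ β
    set c : ℝ := ((blanket i₀ β).card : ℝ) with hcdef
    have h := sum_pi_prod_mul_sum_sub_sq (fun (_ : ι) (_ : Fin (k + 1)) => ((k : ℝ) + 1)⁻¹)
      (fun _ => sum_uniform k)
      (fun i a => if i ∈ blanket i₀ β then c⁻¹ * responseDensity γ k x a else 0) 0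
    have e1 : ∀ i, ∑ a, ((k : ℝ) + 1)⁻¹
        * (if i ∈ blanket i₀ β then c⁻¹ * responseDensity γ k x a else 0)
        = if i ∈ blanket i₀ β then c⁻¹ else 0 := by
      intro i
      split_ifs
      · simp_rw [mul_left_comm _ c⁻¹]
        rw [← mul_sum, sum_responseDensity, mul_one]
      · simp
    have e2 : ∀ i, ∑ a, ((k : ℝ) + 1)⁻¹
        * (if i ∈ blanket i₀ β then c⁻¹ * responseDensity γ k x a else 0) ^ 2
        ≤ if i ∈ blanket i₀ β then c⁻¹ ^ 2 * (1 + k) else 0 := by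
      intro i
      split_ifs
      · simp_rw [mul_pow, mul_left_comm _ (c⁻¹ ^ 2)]
        rw [← mul_sum]
        exact mul_le_mul_of_nonneg_left (sum_responseDensity_sq_le h0.le h1 k x) (sq_nonneg _)
      · simp
    have e3 : ∀ u : ι → Fin (k + 1), blanketDensity γ i₀ x (β, u)
        = ∑ i, (if i ∈ blanket i₀ β then c⁻¹ * responseDensity γ k x (u i) else 0) - 0 := by
      intro u
      rw [sub_zero, sum_ite_mem, univ_inter, ← mul_sum]
      rfl
    simp_rw [e3]
    rw [h]
    simp_rw [e1]
    have hcc : c * c⁻¹ = 1 := mul_inv_cancel₀ hc.ne'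
    have e4 : ∑ i, (if i ∈ blanket i₀ β then c⁻¹ else 0) = 1 := by
      rw [sum_ite_mem, univ_inter, sum_const, nsmul_eq_mul, hcc]
    rw [e4]
    have e5 : ∑ i, (∑ a, ((k : ℝ) + 1)⁻¹
        * (if i ∈ blanket i₀ β then c⁻¹ * responseDensity γ k x a else 0) ^ 2
          - (if i ∈ blanket i₀ β then c⁻¹ else 0) ^ 2)
        ≤ ∑ i, if i ∈ blanket i₀ β then c⁻¹ ^ 2 * k else 0 := by
      refine sum_le_sum fun i _ => ?_
      have := e2 i
      split_ifs at this ⊢ <;> linarith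
    have e6 : ∑ i, (if i ∈ blanket i₀ β then c⁻¹ ^ 2 * (k : ℝ) else 0) = c⁻¹ * k := by
      rw [sum_ite_mem, univ_inter, sum_const, nsmul_eq_mul, sq, ← hcdef]
      linear_combination (c⁻¹ * k) * hcc
    linarith
  have hw : ∀ β : ι → Bool, 0 ≤ ∏ i, coinWeight γ (β i) :=
    fun β => prod_nonneg fun i _ => coinWeight_nonneg h0.le h1 _
  rw [Fintype.sum_prod_type]
  calc ∑ β : ι → Bool, ∑ u : ι → Fin (k + 1),
        blanketWeight γ k (β, u) * blanketDensity γ i₀ x (β, u) ^ 2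
      ≤ ∑ β : ι → Bool, (∏ i, coinWeight γ (β i)) * (1 + ((blanket i₀ β).card : ℝ)⁻¹ * k) := by
        refine sum_le_sum fun β _ => ?_
        simp only [blanketWeight, mul_assoc, ← mul_sum]
        exact mul_le_mul_of_nonneg_left (by simpa only [mul_sum] using inner β) (hw β)
    _ = 1 + k * ∑ β : ι → Bool, (∏ i, coinWeight γ (β i)) * ((blanket i₀ β).card : ℝ)⁻¹ := by
        simp_rw [mul_add, mul_one, sum_add_distrib]
        rw [sum_pi_prod_eq_one (fun (_ : ι) b => coinWeight γ b) fun _ => sum_coinWeight γ, mul_sum]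
        exact congrArg _ (sum_congr rfl fun β _ => by ring)
    _ ≤ 1 + k / (Fintype.card ι * γ) := by
        have h := sum_inv_card_blanket_le h0.le h1 i₀
        rw [div_eq_mul_inv]
        have h' : ∑ β : ι → Bool, (∏ i, coinWeight γ (β i)) * ((blanket i₀ β).card : ℝ)⁻¹
            ≤ (Fintype.card ι * γ)⁻¹ := by
          rw [← one_div, le_div_iff₀ (by positivity), mul_comm]
          exact h
        gcongr

end Blanket

end

end ShuffleModel

namespace ShuffleModel

open Finset

noncomputable section

/-! ### Expectations under finite laws -/

section Expectation

/-- The expectation of a real function on a finite type. -/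
def expect {α : Type*} [Fintype α] (p : PMF α) (f : α → ℝ) : ℝ := ∑ a, (p a).toReal * f a

variable {α β : Type*} [Fintype α]

theorem toReal_bind_apply (p : PMF α) (r : α → PMF β) (b : β) :
    (p.bind r b).toReal = ∑ a, (p a).toReal * (r a b).toReal := by
  rw [PMF.bind_apply, tsum_fintype, ENNReal.toReal_sum fun a _ =>
    ENNReal.mul_ne_top (p.apply_ne_top a) ((r a).apply_ne_top b)]
  simp_rw [ENNReal.toReal_mul]

theorem sum_toReal (p : PMF α) : ∑ a, (p a).toReal = 1 := by
  rw [← ENNReal.toReal_sum fun a _ => p.apply_ne_top a, ← tsum_fintype (L := .unconditional _),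
    p.tsum_coe, ENNReal.toReal_one]

variable [Fintype β]

theorem expect_bind (p : PMF α) (r : α → PMF β) (f : β → ℝ) :
    expect (p.bind r) f = expect p fun a => expect (r a) f := by
  simp only [expect, toReal_bind_apply, sum_mul, mul_sum]
  rw [sum_comm]
  simp only [mul_assoc]

theorem expect_pure (a : α) (f : α → ℝ) : expect (PMF.pure a) f = f a := by
  classical
  rw [expect, sum_eq_single a]
  · simp
  · intro b _ hb
    simp [hb]
  · simp

theorem expect_map (p : PMF α) (g : α → β) (f : β → ℝ) :
    expect (p.map g) f = expect p fun a => f (g a) := by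
  rw [PMF.map, expect_bind]
  simp only [Function.comp_apply, expect_pure]

theorem toReal_toOuterMeasure (p : PMF α) (E : Set α) :
    (p.toOuterMeasure E).toReal = expect p (E.indicator 1) := by
  rw [PMF.toOuterMeasure_apply_fintype, ENNReal.toReal_sum, expect]
  · refine sum_congr rfl fun a _ => ?_
    by_cases h : a ∈ E <;> simp [h]
  · intro a _
    by_cases h : a ∈ E <;> simp [h, p.apply_ne_top]

theorem tsum_map_mul (p : PMF α) {O : Type*} (g : α → O) (f : O → ENNReal) :
    ∑' z, p.map g z * f z = ∑ a, p a * f (g a) := by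
  classical
  simp_rw [PMF.map_apply, ← ENNReal.tsum_mul_right]
  rw [ENNReal.tsum_comm, tsum_fintype]
  refine sum_congr rfl fun a _ => ?_
  rw [tsum_eq_single (g a)]
  · simp
  · intro z hz
    simp [hz]

theorem tsum_map_mul_ofReal (p : PMF α) {O : Type*} (g : α → O) (f : O → ℝ) (hf : ∀ z, 0 ≤ f z) :
    ∑' z, p.map g z * ENNReal.ofReal (f z) = ENNReal.ofReal (expect p fun a => f (g a)) := by
  rw [tsum_map_mul, expect, ENNReal.ofReal_sum_of_nonneg fun a _ =>
    mul_nonneg ENNReal.toReal_nonneg (hf _)]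
  refine sum_congr rfl fun a _ => ?_
  rw [ENNReal.ofReal_mul ENNReal.toReal_nonneg, ENNReal.ofReal_toReal (p.apply_ne_top a)]

theorem toReal_indep_apply {ι : Type*} [Fintype ι] [DecidableEq ι] {α : ι → Type*}
    [∀ i, Fintype (α i)] (P : ∀ i, PMF (α i)) (y : ∀ i, α i) :
    (indep P y).toReal = ∏ i, (P i (y i)).toReal := by
  rw [indep, PMF.ofFintype_apply, ENNReal.toReal_prod]

theorem toReal_coin_apply (t : unitInterval) (b : Bool) : (coin t b).toReal = coinWeight t b := by
  rw [coin, PMF.ofFintype_apply]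
  cases b
  · simp [coinWeight, ENNReal.toReal_ofReal (sub_nonneg.2 t.2.2)]
  · simp [coinWeight, t.2.1]

theorem toReal_randomizedResponse_apply (γ : unitInterval) (k : ℕ) (x y : Fin (k + 1)) :
    (randomizedResponse γ k x y).toReal = responseWeight γ k x y := by
  rw [randomizedResponse, toReal_bind_apply, Fintype.sum_bool]
  simp only [toReal_coin_apply, coinWeight, cond_true, cond_false, PMF.uniformOfFintype_apply,
    PMF.pure_apply, Fintype.card_fin, responseWeight]
  rw [add_comm]
  congr 1
  · split_ifs <;> simp
  · rw [ENNReal.toReal_inv, ENNReal.toReal_natCast]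
    push_cast
    rfl

end Expectation

/-! ### The view as a mixture of products -/

section View

variable {n : ℕ}

/-- The probability that shuffling `y` gives `v`. -/
def shuffleWeight {X : Type*} [DecidableEq X] (y v : Fin n → X) : ℝ :=
  ∑ σ : Equiv.Perm (Fin n), ((Fintype.card (Equiv.Perm (Fin n)) : ℝ))⁻¹ * if y ∘ σ = v then 1 else 0

theorem sum_inv_card_perm :
    ∑ _σ : Equiv.Perm (Fin n), ((Fintype.card (Equiv.Perm (Fin n)) : ℝ))⁻¹ = 1 := by
  rw [sum_const, card_univ, nsmul_eq_mul, mul_inv_cancel₀]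
  exact Nat.cast_ne_zero.2 Fintype.card_ne_zero

theorem shuffleWeight_nonneg {X : Type*} [DecidableEq X] (y v : Fin n → X) :
    0 ≤ shuffleWeight y v :=
  sum_nonneg fun σ _ => mul_nonneg (by positivity) (by split_ifs <;> norm_num)

theorem sum_shuffleWeight {X : Type*} [DecidableEq X] [Fintype X] (y : Fin n → X) :
    ∑ v, shuffleWeight y v = 1 := by
  simp only [shuffleWeight]
  rw [sum_comm]
  simp only [← mul_sum, sum_ite_eq, mem_univ, if_true, mul_one]
  exact sum_inv_card_perm

/-- A uniform permutation stays uniform after multiplication by `τ`. This is the symmetry that the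
averaging over the blanket requires. -/
theorem shuffleWeight_comp {X : Type*} [DecidableEq X] (y v : Fin n → X)
    (τ : Equiv.Perm (Fin n)) : shuffleWeight (y ∘ τ) v = shuffleWeight y v := by
  refine Fintype.sum_equiv (Equiv.mulLeft τ) _ _ fun σ => ?_
  simp only [Equiv.coe_mulLeft, Equiv.Perm.coe_mul, Function.comp_assoc]
  congr

/-- The law of the output of one shuffler on randomized responses to the inputs `s`. -/
def shuffledResponse (γ : ℝ) {k : ℕ} (s v : Fin n → Fin (k + 1)) : ℝ :=
  ∑ y : Fin n → Fin (k + 1), (∏ i, responseWeight γ k (s i) (y i)) * shuffleWeight y v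

variable {m : ℕ}

/-- The output of `m` shufflers depends on one user by little. -/
theorem sq_sum_shuffledResponse_sub_le (γ : Fin m → ℝ) (h0 : ∀ j, 0 < γ j) (h1 : ∀ j, γ j ≤ 1)
    (k : Fin m → ℕ) (i₀ : Fin n) (s : ∀ j, Fin n → Fin (k j + 1))
    (f : (∀ j, Fin n → Fin (k j + 1)) → ℝ) (hf0 : ∀ v, 0 ≤ f v) (hf1 : ∀ v, f v ≤ 1) :
    (∑ v : ∀ j, Fin n → Fin (k j + 1), (∏ j, shuffledResponse (γ j) (s j) (v j)) * f v
      - ∑ v : ∀ j, Fin n → Fin (k j + 1), (∏ j, ∑ ω, blanketWeight (γ j) (k j) ω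
          * shuffleWeight (blanketMessages i₀ (s j) ω) (v j)) * f v) ^ 2
      ≤ Real.exp (∑ j, k j / (n * γ j)) - 1 := by
  have e : ∀ j v, shuffledResponse (γ j) (s j) v = ∑ ω, blanketWeight (γ j) (k j) ω
      * blanketDensity (γ j) i₀ (s j i₀) ω * shuffleWeight (blanketMessages i₀ (s j) ω) v :=
    fun j v => sum_response_eq_sum_blanketDensity (γ j) i₀ (s j) (fun y => shuffleWeight y v)
      fun y τ => shuffleWeight_comp y v τ
  simp_rw [e]
  exact sq_sum_pi_prod_sub_le (fun j => blanketWeight (γ j) (k j))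
    (fun j => blanketDensity (γ j) i₀ (s j i₀))
    (fun j ω v => shuffleWeight (blanketMessages i₀ (s j) ω) v)
    (fun j ω => blanketWeight_nonneg (h0 j).le (h1 j) (k j) ω)
    (fun j => sum_blanketWeight (γ j) (k j))
    (fun j => sum_blanketWeight_mul_blanketDensity (γ j) i₀ (s j i₀))
    (fun j => k j / (n * γ j))
    (fun j => by
      simpa using sum_blanketWeight_mul_blanketDensity_sq_le (h0 j) (h1 j) i₀ (s j i₀))
    (fun j ω v => shuffleWeight_nonneg _ v) (fun j ω => sum_shuffleWeight _) f hf0 hf1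

variable [NeZero m]

theorem toReal_randomizer_apply (p : Fin m → ℕ) (γ : Fin m → unitInterval)
    (x : Set.Icc (0 : ℝ) 1) (y : ∀ j, Fin (precision p j + 1)) :
    ((recursiveProtocol n p γ).randomizer x y).toReal
      = ∑ r, coinWeight (roundUpProb p x) r
          * ∏ j, responseWeight (γ j) (precision p j) (encoding p x r j) (y j) := by
  rw [recursiveProtocol, toReal_bind_apply]
  simp only [toReal_coin_apply, toReal_indep_apply, toReal_randomizedResponse_apply]

/-- The view, conditioned on the roundings `r`, is a product over the shufflers. -/
theorem expect_view (p : Fin m → ℕ) (γ : Fin m → unitInterval) (x : Fin n → Set.Icc (0 : ℝ) 1)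
    (f : (∀ j, Fin n → Fin (precision p j + 1)) → ℝ) :
    expect ((recursiveProtocol n p γ).view x) f
      = ∑ r : Fin n → Bool, (∏ i, coinWeight (roundUpProb p (x i)) (r i))
          * ∑ v : ∀ j, Fin n → Fin (precision p j + 1),
            (∏ j, shuffledResponse (γ j) (fun i => encoding p (x i) (r i) j) (v j)) * f v := by
  rw [Protocol.view, expect_bind]
  simp only [expect_map]
  have shuffle : ∀ y : Fin n → ∀ j, Fin (precision p j + 1),
      expect (indep fun _ : Fin m => PMF.uniformOfFintype (Equiv.Perm (Fin n)))
          (fun σ => f fun j i => y (σ j i) j)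
        = ∑ v : ∀ j, Fin n → Fin (precision p j + 1),
          (∏ j, shuffleWeight (fun i => y i j) (v j)) * f v := by
    intro y
    simp only [expect, toReal_indep_apply, PMF.uniformOfFintype_apply, ENNReal.toReal_inv,
      ENNReal.toReal_natCast]
    exact (sum_pi_prod_push
      (fun (_ : Fin m) (_ : Equiv.Perm (Fin n)) => (Fintype.card (Equiv.Perm (Fin n)) : ℝ)⁻¹)
      (fun j (σ : Equiv.Perm (Fin n)) => (fun i => y i j) ∘ σ) f).symm
  simp_rw [shuffle]
  simp only [expect, toReal_indep_apply, toReal_randomizer_apply, Fintype.prod_sum, sum_mul]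
  rw [sum_comm]
  refine sum_congr rfl fun r _ => ?_
  simp only [prod_mul_distrib, mul_assoc, ← mul_sum]
  congr 1
  simp only [mul_sum, shuffledResponse, Fintype.prod_sum, sum_mul]
  rw [sum_comm]
  refine sum_congr rfl fun v _ => ?_
  -- Messages grouped by user are regrouped by shuffler.
  refine Fintype.sum_equiv (Equiv.piComm fun _ j => Fin (precision p j + 1)) _ _ fun y => ?_
  rw [prod_comm, prod_mul_distrib, mul_assoc]
  rfl

/-- The recursive protocol is private in total variation, hence for every `ε ≥ 0`. -/
theorem recursiveProtocol_isDP (p : Fin m → ℕ) (γ : Fin m → unitInterval)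
    (h0 : ∀ j, 0 < (γ j : ℝ)) {ε δ : ℝ} (hε : 0 ≤ ε) (hδ : 0 ≤ δ)
    (h : Real.exp (∑ j, (precision p j : ℝ) / (n * γ j)) - 1 ≤ (δ / 2) ^ 2) :
    (recursiveProtocol n p γ).IsDP ε δ := by
  rintro x x' ⟨i₀, hi₀⟩ E
  rw [toReal_toOuterMeasure, toReal_toOuterMeasure]
  set f : (∀ j, Fin n → Fin (precision p j + 1)) → ℝ := E.indicator 1
  have hf0 : ∀ v, 0 ≤ f v := fun v => Set.indicator_nonneg (fun _ _ => zero_le_one) v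
  have hf1 : ∀ v, f v ≤ 1 := fun v => Set.indicator_le_self' (fun _ _ => zero_le_one) v
  let c : (Fin n → Set.Icc (0 : ℝ) 1) → Fin n → Bool → ℝ := fun x i =>
    coinWeight (roundUpProb p (x i))
  -- The reference probability of `E` given the roundings: user `i₀` sends uniform messages, so
  -- neither its input nor its rounding matters.
  let R : (Fin n → Set.Icc (0 : ℝ) 1) → (Fin n → Bool) → ℝ := fun x r =>
    ∑ v : ∀ j, Fin n → Fin (precision p j + 1), (∏ j, ∑ ω,
      blanketWeight (γ j) (precision p j) ω * shuffleWeight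
        (blanketMessages i₀ (fun i => encoding p (x i) (r i) j) ω) (v j)) * f v
  have hc : ∀ x (r : Fin n → Bool), 0 ≤ ∏ i, c x i (r i) := fun x r =>
    prod_nonneg fun i _ => coinWeight_nonneg (roundUpProb p (x i)).2.1 (roundUpProb p (x i)).2.2 _
  have hc1 : ∀ x, ∑ r : Fin n → Bool, ∏ i, c x i (r i) = 1 := fun x =>
    sum_pi_prod_eq_one (c x) fun i => sum_coinWeight _
  have close : ∀ x, |expect ((recursiveProtocol n p γ).view x) f
      - ∑ r : Fin n → Bool, (∏ i, c x i (r i)) * R x r| ≤ δ / 2 := by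
    intro x
    rw [expect_view, ← sum_sub_distrib]
    refine (abs_sum_le_sum_abs _ _).trans ?_
    rw [← one_mul (δ / 2), ← hc1 x, sum_mul]
    refine sum_le_sum fun r _ => ?_
    rw [← mul_sub, abs_mul, abs_of_nonneg (hc x r)]
    refine mul_le_mul_of_nonneg_left (abs_le_of_sq_le_sq ?_ (by positivity)) (hc x r)
    exact (sq_sum_shuffledResponse_sub_le (fun j => (γ j : ℝ)) h0 (fun j => (γ j).2.2) (precision p)
      i₀ (fun j i => encoding p (x i) (r i) j) f hf0 hf1).trans h
  have messages : ∀ {x x' : Fin n → Set.Icc (0 : ℝ) 1} {r r' : Fin n → Bool},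
      (∀ i, i ≠ i₀ → x i = x' i) → (∀ i, i ≠ i₀ → r i = r' i) → R x r = R x' r' := by
    intro x x' r r' hx hr
    have : ∀ (j : Fin m) ω, blanketMessages i₀ (fun i => encoding p (x i) (r i) j) ω
        = blanketMessages i₀ (fun i => encoding p (x' i) (r' i) j) ω := by
      intro j ω
      funext i
      by_cases hi : i = i₀
      · simp [blanketMessages, hi]
      · simp only [blanketMessages, hx i hi, hr i hi]
    simp only [R, this]
  have same : ∑ r : Fin n → Bool, (∏ i, c x i (r i)) * R x r
      = ∑ r : Fin n → Bool, (∏ i, c x' i (r i)) * R x' r := by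
    have key := sum_pi_prod_mul_of_update i₀ (c x) (c x') (fun i hi => by simp only [c, hi₀ i hi])
      (R x) fun r b => messages (fun _ _ => rfl) fun i hi => Function.update_of_ne hi _ _
    simp only [c, sum_coinWeight, mul_one] at key
    simp only [c, key]
    exact sum_congr rfl fun r _ => congrArg _ (messages hi₀ fun _ _ => rfl)
  have hx := abs_le.1 (close x)
  have hx' := abs_le.1 (close x')
  have hpos : 0 ≤ expect ((recursiveProtocol n p γ).view x') f :=
    sum_nonneg fun v _ => mul_nonneg ENNReal.toReal_nonneg (hf0 v)
  have hexp : expect ((recursiveProtocol n p γ).view x') f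
      ≤ Real.exp ε * expect ((recursiveProtocol n p γ).view x') f :=
    le_mul_of_one_le_left hpos (Real.one_le_exp hε)
  linarith [hx.2, hx'.1]

end View

end

end ShuffleModel

namespace ShuffleModel

open Finset

noncomputable section

/-! ### Mean squared error -/

section Error

variable {n m : ℕ}

theorem sum_responseWeight_mul (γ : ℝ) (k : ℕ) (x : Fin (k + 1)) (f : Fin (k + 1) → ℝ) :
    ∑ y, responseWeight γ k x y * f y
      = (1 - γ) * f x + γ * (((k : ℝ) + 1)⁻¹ * ∑ y, f y) := by
  simp only [responseWeight, add_mul, sum_add_distrib, mul_assoc, ite_mul, one_mul, zero_mul,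
    ← mul_sum, sum_ite_eq', mem_univ, if_true]

theorem sum_fin_val (k : ℕ) : ((k : ℝ) + 1)⁻¹ * ∑ y : Fin (k + 1), ((y : ℕ) : ℝ) = k / 2 := by
  have h : (∑ y : Fin (k + 1), ((y : ℕ) : ℝ)) * 2 = (k + 1) * k := by
    rw [Fin.sum_univ_eq_sum_range (fun i => (i : ℝ)) (k + 1)]
    have := Finset.sum_range_id_mul_two (k + 1)
    rw [Nat.add_sub_cancel] at this
    have h' : (((∑ i ∈ range (k + 1), i) * 2 : ℕ) : ℝ) = ((k + 1) * k : ℕ) := by rw [this]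
    push_cast at h'
    exact h'
  have : (k : ℝ) + 1 ≠ 0 := by positivity
  field_simp
  linarith

/-- The debiased value of one message. -/
def debias (γ : ℝ) (k : ℕ) (y : Fin (k + 1)) : ℝ := (((y : ℕ) : ℝ) - γ * k / 2) / (1 - γ)

theorem sum_responseWeight_mul_debias {γ : ℝ} (h1 : γ < 1) (k : ℕ) (x : Fin (k + 1)) :
    ∑ y, responseWeight γ k x y * debias γ k y = (x : ℕ) := by
  have h : 1 - γ ≠ 0 := (sub_pos.2 h1).ne'
  have hk : (k : ℝ) + 1 ≠ 0 := by positivity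
  have e : ∑ y : Fin (k + 1), debias γ k y
      = (∑ y : Fin (k + 1), ((y : ℕ) : ℝ) - (k + 1) * (γ * k / 2)) / (1 - γ) := by
    simp only [debias, ← sum_div, sum_sub_distrib, sum_const, card_univ, Fintype.card_fin,
      nsmul_eq_mul, Nat.cast_add, Nat.cast_one]
    ring
  rw [sum_responseWeight_mul, e, mul_div_assoc', mul_sub, sum_fin_val, inv_mul_cancel_left₀ hk,
    debias]
  field_simp
  ring

/-- The variance is at most the second moment about the debiased true value. Only the uniform part,
of weight `γ`, contributes to it, with deviations at most $k/(1-\gamma)$. -/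
theorem variance_debias_le {γ : ℝ} (h0 : 0 ≤ γ) (h1 : γ < 1) (k : ℕ) (x : Fin (k + 1)) :
    ∑ y, responseWeight γ k x y * debias γ k y ^ 2
        - (∑ y, responseWeight γ k x y * debias γ k y) ^ 2
      ≤ γ * k ^ 2 / (1 - γ) ^ 2 := by
  have h : 0 < 1 - γ := sub_pos.2 h1
  have hk : (k : ℝ) + 1 ≠ 0 := by positivity
  set M : ℝ := ∑ y, responseWeight γ k x y * debias γ k y with hM
  set d : ℝ := debias γ k x with hd
  have e : ∑ y, responseWeight γ k x y * debias γ k y ^ 2 - M ^ 2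
      = ∑ y, responseWeight γ k x y * (debias γ k y - d) ^ 2 - (M - d) ^ 2 := by
    have : ∀ y, responseWeight γ k x y * (debias γ k y - d) ^ 2
        = responseWeight γ k x y * debias γ k y ^ 2
          - 2 * d * (responseWeight γ k x y * debias γ k y)
          + d ^ 2 * responseWeight γ k x y := fun y => by ring
    simp_rw [this, sum_add_distrib, sum_sub_distrib, ← mul_sum, sum_responseWeight, ← hM]
    ring
  rw [e, sum_responseWeight_mul, ← hd]
  have b : ∀ y : Fin (k + 1), (debias γ k y - d) ^ 2 ≤ k ^ 2 / (1 - γ) ^ 2 := by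
    intro y
    have : debias γ k y - d = (((y : ℕ) : ℝ) - (x : ℕ)) / (1 - γ) := by
      rw [hd, debias, debias]
      ring
    rw [this, div_pow]
    refine div_le_div_of_nonneg_right ?_ (by positivity)
    have hy : ((y : ℕ) : ℝ) ≤ k := Nat.cast_le.2 (Nat.lt_succ_iff.1 y.2)
    have hx : ((x : ℕ) : ℝ) ≤ k := Nat.cast_le.2 (Nat.lt_succ_iff.1 x.2)
    have hy0 : (0 : ℝ) ≤ (y : ℕ) := Nat.cast_nonneg _
    have hx0 : (0 : ℝ) ≤ (x : ℕ) := Nat.cast_nonneg _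
    exact sq_le_sq' (by linarith) (by linarith)
  have s : ((k : ℝ) + 1)⁻¹ * ∑ y, (debias γ k y - d) ^ 2 ≤ k ^ 2 / (1 - γ) ^ 2 := by
    rw [inv_mul_le_iff₀ (by positivity)]
    refine (sum_le_sum fun y _ => b y).trans_eq ?_
    simp
  have := mul_le_mul_of_nonneg_left s h0
  rw [mul_div_assoc]
  nlinarith [sq_nonneg (M - d)]

theorem q_pos {p : Fin m → ℕ} (hp : ∀ j, 0 < p j) (j : Fin m) : 0 < q p (j + 1) := by
  rw [q, if_neg (Nat.succ_ne_zero _)]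
  exact prod_pos fun l _ => hp l

theorem natCast_digit (p : Fin m → ℕ) (x : Set.Icc (0 : ℝ) 1) (j : Fin m) :
    (digit p x j : ℝ) = ⌊(q p (j + 1) : ℝ) * x⌋ - p j * ⌊(q p j : ℝ) * (x : ℝ)⌋ := by
  rw [digit, natCast_floor_eq_intCast_floor (residual_mem p x x.2 j).1, residual]
  rw [show (q p (j + 1) : ℝ) * x - (p j : ℝ) * (⌊(q p j : ℝ) * (x : ℝ)⌋ : ℝ)
    = (q p (j + 1) : ℝ) * x - ((p j * ⌊(q p j : ℝ) * (x : ℝ)⌋ : ℤ) : ℝ) by push_cast; rfl,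
    Int.floor_sub_intCast]
  push_cast
  rfl

/-- The telescoping form of the digits. At the first digit `q p 0 = 0`, and division by zero makes
the subtracted term vanish, as it should. -/
theorem digit_div_q {p : Fin m → ℕ} (hp : ∀ j, 0 < p j) (x : Set.Icc (0 : ℝ) 1) (j : Fin m) :
    (digit p x j : ℝ) / q p (j + 1)
      = ⌊(q p (j + 1) : ℝ) * x⌋ / q p (j + 1) - ⌊(q p j : ℝ) * (x : ℝ)⌋ / q p j := by
  rw [natCast_digit, sub_div]
  congr 1
  rcases eq_or_ne j.val 0 with hj | hj
  · simp [hj, q]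
  · have h1 : (p j : ℝ) ≠ 0 := Nat.cast_ne_zero.2 (hp j).ne'
    rw [q_succ p j hj, Nat.cast_mul, mul_div_mul_left _ _ h1]

variable [NeZero m]

/-- The digits determine the input up to the rounding. -/
theorem sum_encoding_div_q {p : Fin m → ℕ} (hp : ∀ j, 0 < p j) (x : Set.Icc (0 : ℝ) 1) (r : Bool) :
    ∑ j, ((encoding p x r j : ℕ) : ℝ) / q p (j + 1) - x
      = ((if r = true then 1 else 0) - roundUpProb p x) / q p m := by
  have hm : ((⊤ : Fin m) : ℕ) + 1 = m := by
    obtain ⟨l, rfl⟩ := Nat.exists_eq_succ_of_ne_zero (NeZero.ne m)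
    rfl
  have hq : (q p m : ℝ) ≠ 0 := by
    have := q_pos hp ⊤
    rw [hm] at this
    exact Nat.cast_ne_zero.2 this.ne'
  have hd : ∑ j, (digit p x j : ℝ) / q p (j + 1) = ⌊(q p m : ℝ) * (x : ℝ)⌋ / q p m := by
    rw [sum_congr rfl fun j _ => digit_div_q hp x j,
      Fin.sum_univ_eq_sum_range (fun j => (⌊(q p (j + 1) : ℝ) * (x : ℝ)⌋ : ℝ) / q p (j + 1)
        - ⌊(q p j : ℝ) * (x : ℝ)⌋ / q p j) m,
      sum_range_sub (fun j => (⌊(q p j : ℝ) * (x : ℝ)⌋ : ℝ) / q p j)]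
    simp [q]
  have he : ∀ j, ((encoding p x r j : ℕ) : ℝ) / q p (j + 1) = (digit p x j : ℝ) / q p (j + 1)
      + if j = ⊤ then (if r = true then 1 else 0) / (q p (j + 1) : ℝ) else 0 := by
    intro j
    simp only [encoding]
    split_ifs <;> simp [add_div]
  have hr : (roundUpProb p x : ℝ) = q p m * x - ⌊(q p m : ℝ) * (x : ℝ)⌋ := by
    have h := natCast_digit p x ⊤
    rw [hm] at h
    simp only [roundUpProb, residual]
    rw [hm, h]
    ring
  rw [sum_congr rfl fun j _ => he j, sum_add_distrib, hd, sum_ite_eq' univ ⊤, if_pos (mem_univ _),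
    hm, hr]
  field_simp
  ring

/-- The contribution of one user to the output of the analyzer. -/
def userOutput (p : Fin m → ℕ) (γ : Fin m → unitInterval) (y : ∀ j, Fin (precision p j + 1)) : ℝ :=
  ∑ j, debias (γ j) (precision p j) (y j) / q p (j + 1)

theorem analyzer_eq (p : Fin m → ℕ) (γ : Fin m → unitInterval)
    (v : ∀ j, Fin n → Fin (precision p j + 1)) (σ : Fin m → Equiv.Perm (Fin n)) :
    (recursiveProtocol n p γ).analyzer (fun j i => v j (σ j i))
      = ∑ i, userOutput p γ fun j => v j i := by
  simp only [recursiveProtocol, userOutput, debiasedSum]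
  rw [sum_comm]
  refine sum_congr rfl fun j _ => ?_
  rw [← sum_div, Equiv.sum_comp (σ j) fun i => ((v j i : ℕ) : ℝ)]
  simp only [debias, ← sum_div, sum_sub_distrib, sum_const, card_univ, Fintype.card_fin,
    nsmul_eq_mul]
  congr 2
  ring

/-- Mean and mean squared error of the contribution of one user. -/
theorem userOutput_error {p : Fin m → ℕ} (hp : ∀ j, 0 < p j) (γ : Fin m → unitInterval)
    (h1 : ∀ j, (γ j : ℝ) < 1) (x : Set.Icc (0 : ℝ) 1) :
    ∑ y, ((recursiveProtocol n p γ).randomizer x y).toReal * (userOutput p γ y - x) = 0 ∧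
      ∑ y, ((recursiveProtocol n p γ).randomizer x y).toReal * (userOutput p γ y - x) ^ 2
        ≤ ∑ j, (γ j : ℝ) * precision p j ^ 2 / (1 - γ j) ^ 2 / (q p (j + 1) : ℝ) ^ 2
          + 1 / (q p m : ℝ) ^ 2 := by
  have swap : ∀ g : (∀ j, Fin (precision p j + 1)) → ℝ,
      ∑ y, ((recursiveProtocol n p γ).randomizer x y).toReal * g y
        = ∑ r, coinWeight (roundUpProb p x) r * ∑ y : ∀ j, Fin (precision p j + 1),
          (∏ j, responseWeight (γ j) (precision p j) (encoding p x r j) (y j)) * g y := by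
    intro g
    simp only [toReal_randomizer_apply, sum_mul, mul_sum]
    rw [sum_comm]
    simp only [mul_assoc]
  let f : ∀ j, Fin (precision p j + 1) → ℝ := fun j a =>
    debias (γ j) (precision p j) a / q p (j + 1)
  let w : Bool → ∀ j, Fin (precision p j + 1) → ℝ := fun r j =>
    responseWeight (γ j) (precision p j) (encoding p x r j)
  have hw : ∀ r j, ∑ a, w r j a = 1 := fun r j => sum_responseWeight _ _ _
  have mean : ∀ r j, ∑ a, w r j a * f j a = ((encoding p x r j : ℕ) : ℝ) / q p (j + 1) := by
    intro r j
    simp only [f, w, mul_div_assoc', ← sum_div]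
    rw [sum_responseWeight_mul_debias (h1 j)]
  have hroot := (roundUpProb p x).2
  constructor
  · rw [swap]
    have : ∀ r, ∑ y : ∀ j, Fin (precision p j + 1), (∏ j, w r j (y j)) * (userOutput p γ y - x)
        = ((if r = true then 1 else 0) - roundUpProb p x) / q p m := by
      intro r
      rw [← sum_encoding_div_q hp x r]
      simp only [mul_sub, sum_sub_distrib, userOutput, ← sum_mul]
      rw [sum_pi_prod_eq_one (w r) (hw r), one_mul]
      simp_rw [mul_sum]
      rw [sum_comm]
      simp_rw [← mean r]
      exact congrArg (· - (x : ℝ))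
        (sum_congr rfl fun j _ => sum_pi_prod_mul_apply (w r) (hw r) f j)
    rw [sum_congr rfl fun r _ => congrArg _ (this r)]
    simp only [Fintype.sum_bool, coinWeight, cond_true, cond_false, if_true, Bool.false_eq_true,
      if_false]
    ring
  · rw [swap]
    set V := ∑ j, (γ j : ℝ) * precision p j ^ 2 / (1 - γ j) ^ 2 / (q p (j + 1) : ℝ) ^ 2
    have : ∀ r, ∑ y : ∀ j, Fin (precision p j + 1), (∏ j, w r j (y j)) * (userOutput p γ y - x) ^ 2
        ≤ V + 1 / (q p m : ℝ) ^ 2 := by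
      intro r
      have h := sum_pi_prod_mul_sum_sub_sq (w r) (hw r) f x
      refine h.trans_le ?_
      -- Given the rounding `r`, the messages are independent: the error is the sum of their
      -- variances plus the squared bias, and the bias is at most $1/q_m$ in absolute value.
      rw [sum_congr rfl fun j _ => mean r j, sum_encoding_div_q hp x r, add_comm, div_pow]
      refine add_le_add (sum_le_sum fun j _ => ?_) (div_le_div_of_nonneg_right ?_ (sq_nonneg _))
      · have hv := variance_debias_le (γ j).2.1 (h1 j) (precision p j) (encoding p x r j)
        have := div_le_div_of_nonneg_right hv (sq_nonneg (q p (j + 1) : ℝ))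
        refine le_trans (le_of_eq ?_) this
        simp only [f, w, div_pow, mul_div_assoc', ← sum_div, sub_div]
      · cases r
        · simp only [Bool.false_eq_true, if_false]
          nlinarith [hroot.1, hroot.2]
        · simp only [if_true]
          nlinarith [hroot.1, hroot.2]
    refine (sum_le_sum fun r _ => mul_le_mul_of_nonneg_left (this r)
      (coinWeight_nonneg hroot.1 hroot.2 r)).trans_eq ?_
    rw [← sum_mul, sum_coinWeight, one_mul]

/-- The analyzer only sums, so shuffling has no effect on it. The errors of the users are
independent and centred, hence their second moments add. -/
theorem recursiveProtocol_mse_le {p : Fin m → ℕ} (hp : ∀ j, 0 < p j) (γ : Fin m → unitInterval)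
    (h1 : ∀ j, (γ j : ℝ) < 1) :
    (recursiveProtocol n p γ).mse ≤ ENNReal.ofReal (n *
      (∑ j, (γ j : ℝ) * precision p j ^ 2 / (1 - γ j) ^ 2 / (q p (j + 1) : ℝ) ^ 2
        + 1 / (q p m : ℝ) ^ 2)) := by
  refine iSup_le fun x => ?_
  rw [Protocol.mechanism, tsum_map_mul_ofReal _ _ (fun z => (z - ∑ i, (x i : ℝ)) ^ 2)
    fun z => sq_nonneg _]
  refine ENNReal.ofReal_le_ofReal ?_
  rw [Protocol.view, expect_bind]
  simp only [expect_map]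
  have e : ∀ y : Fin n → ∀ j, Fin (precision p j + 1),
      expect (indep fun _ : Fin m => PMF.uniformOfFintype (Equiv.Perm (Fin n)))
        (fun σ => ((recursiveProtocol n p γ).analyzer (fun j i => y (σ j i) j)
          - ∑ i, (x i : ℝ)) ^ 2)
        = (∑ i, (userOutput p γ (y i) - x i) - 0) ^ 2 := by
    intro y
    simp only [analyzer_eq p γ (fun j i => y i j), expect, ← sum_mul, sum_toReal, one_mul,
      sum_sub_distrib, sub_zero]
  simp_rw [e]
  simp only [expect, toReal_indep_apply]
  have key := fun i => userOutput_error (n := n) hp γ h1 (x i)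
  have h := sum_pi_prod_mul_sum_sub_sq
    (fun i y => ((recursiveProtocol n p γ).randomizer (x i) y).toReal) (fun i => sum_toReal _)
    (fun i y => userOutput p γ y - x i) 0
  refine h.trans_le ?_
  simp only [(key _).1, sum_const_zero, sub_zero, ne_eq, OfNat.ofNat_ne_zero, not_false_eq_true,
    zero_pow, zero_add]
  refine (sum_le_sum fun i _ => (key i).2).trans_eq ?_
  rw [sum_const, card_univ, Fintype.card_fin, nsmul_eq_mul]

end Error

end

end ShuffleModel

namespace ShuffleModel

open Finset

/-! ### The choice of the parameters -/

/-- This is $3+2(3+\dots+3^{j+1})=3^{j+2}$ in the exponent. It makes $p_j^3/q_j^2$ the same at every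
level, and makes $q_m^2$ comparable with $n$ at the last one. -/
theorem eight_mul_sq_q {m : ℕ} (j : Fin m) :
    8 * q (fun i : Fin m => 2 ^ (3 ^ (i.val + 1))) (j + 1) ^ 2 = (2 ^ (3 ^ (j.val + 1))) ^ 3 := by
  obtain ⟨j, hj⟩ := j
  induction j with
  | zero =>
    rw [q_one _ ⟨0, hj⟩ rfl]
    norm_num
  | succ j ih =>
    have h := ih (Nat.lt_of_succ_lt hj)
    rw [q_succ _ ⟨j + 1, hj⟩ (Nat.succ_ne_zero j), mul_pow, mul_left_comm, h, ← pow_mul 2 _ 3,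
      ← pow_succ 3 (j + 1), pow_succ _ 2]

theorem exp_sub_one_le {t : ℝ} (h0 : 0 ≤ t) (h1 : t ≤ 1 / 2) : Real.exp t - 1 ≤ 2 * t := by
  have h := Real.one_sub_le_exp_neg t
  have e : Real.exp t * Real.exp (-t) = 1 := by rw [← Real.exp_add]; simp
  nlinarith [Real.exp_pos t]

theorem bounds_of_eq_floor_logb {n m : ℕ} (hm0 : m ≠ 0)
    (hm : m = ⌊Real.logb 3 (Real.logb 2 n)⌋₊) :
    (2 : ℝ) ^ (3 ^ m) ≤ n ∧ (n : ℝ) < 2 ^ (3 ^ (m + 1)) ∧ (m : ℝ) / 2 ≤ Real.log (Real.log n) := by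
  have hlow : (m : ℝ) ≤ Real.logb 3 (Real.logb 2 n) := (Nat.le_floor_iff' hm0).1 hm.le
  have hupp : Real.logb 3 (Real.logb 2 n) < (m + 1 : ℕ) := by
    have := Nat.lt_floor_add_one (Real.logb 3 (Real.logb 2 n))
    rw [← hm] at this
    exact_mod_cast this
  have hm1 : (1 : ℝ) ≤ m := by exact_mod_cast Nat.one_le_iff_ne_zero.2 hm0
  -- This also excludes `n = 0`, where `Real.logb` takes its default value `0`.
  have hne : Real.logb 2 n ≠ 0 := fun h => by
    rw [h, Real.logb_zero] at hlow
    linarith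
  have hn : (0 : ℝ) < n := by
    rcases Nat.eq_zero_or_pos n with rfl | h
    · simp at hne
    · exact_mod_cast h
  have hpos : 0 < Real.logb 2 n :=
    lt_of_le_of_ne (Real.logb_nonneg one_lt_two (by exact_mod_cast hn)) hne.symm
  rw [Real.le_logb_iff_rpow_le (by norm_num) hpos, Real.rpow_natCast] at hlow
  rw [Real.logb_lt_iff_lt_rpow (by norm_num) hpos, Real.rpow_natCast] at hupp
  have low : (2 : ℝ) ^ (3 ^ m) ≤ n := by
    have h : ((3 ^ m : ℕ) : ℝ) ≤ Real.logb 2 n := by exact_mod_cast hlow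
    rw [Real.le_logb_iff_rpow_le one_lt_two hn, Real.rpow_natCast] at h
    exact h
  have upp : (n : ℝ) < 2 ^ (3 ^ (m + 1)) := by
    have h : Real.logb 2 n < ((3 ^ (m + 1) : ℕ) : ℝ) := by exact_mod_cast hupp
    rw [Real.logb_lt_iff_lt_rpow one_lt_two hn, Real.rpow_natCast] at h
    exact h
  refine ⟨low, upp, ?_⟩
  -- Since $\log 2\ge 2/3$, this leads to $\log n\ge2^m$, and then $\log\log n\ge m\log2\ge m/2$.
  have h1 : (3 : ℝ) ^ m * (2 / 3) ≤ Real.log n := by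
    have h := Real.log_le_log (by positivity) low
    rw [Real.log_pow] at h
    push_cast at h
    refine le_trans (mul_le_mul_of_nonneg_left ?_ (by positivity)) h
    linarith [Real.log_two_gt_d9]
  have h2 : (2 : ℝ) ^ m ≤ 3 ^ m * (2 / 3) := by
    obtain ⟨l, rfl⟩ := Nat.exists_eq_succ_of_ne_zero hm0
    have : (2 : ℝ) ^ l ≤ 3 ^ l := pow_le_pow_left₀ (by norm_num) (by norm_num) l
    rw [pow_succ, pow_succ]
    linarith
  have h3 := Real.log_le_log (by positivity) (h2.trans h1)
  rw [Real.log_pow] at h3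
  nlinarith [Real.log_two_gt_d9]

end ShuffleModel

open Finset ShuffleModel in
theorem mainTheorem5 :
    ∃ a b : ℝ, 0 < a ∧ 0 < b ∧
      ∀ δ : ℝ, 0 < δ → δ < 1 →
        ∃ K C : ℝ, 0 < K ∧ 0 < C ∧
          ∀ (n m : ℕ) [NeZero m] (ε : ℝ),
            m = ⌊Real.logb 3 (Real.logb 2 n)⌋₊ →
            0 < ε → ε ≤ m → 2 * ε ≤ Real.log (1 / δ) →
            K * m * (2 : ℝ) ^ (3 ^ m) ≤ ε ^ 2 * n →
            ∃ (ε' δ' : Fin m → ℝ) (γ : Fin m → unitInterval),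
              (∀ j, a * (ε / Real.sqrt (m * Real.log (1 / δ))) ≤ ε' j ∧
                ε' j ≤ b * (ε / Real.sqrt (m * Real.log (1 / δ)))) ∧
              (∀ j, 0 < δ' j ∧ δ' j ≤ δ) ∧
              (∀ j, (γ j : ℝ) =
                14 * (ShuffleModel.precision (fun i : Fin m => 2 ^ (3 ^ (i.val + 1))) j : ℝ)
                  * Real.log (2 / δ' j) / (((n : ℝ) - 1) * ε' j ^ 2)) ∧
              (∀ j, (γ j : ℝ) < 1) ∧
              (ShuffleModel.recursiveProtocol n
                (fun i : Fin m => 2 ^ (3 ^ (i.val + 1))) γ).IsDP ε δ ∧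
              (ShuffleModel.recursiveProtocol n
                (fun i : Fin m => 2 ^ (3 ^ (i.val + 1))) γ).mse ≤
                  ENNReal.ofReal (C * (Real.log (Real.log n)) ^ 2 / ε ^ 2) := by
  refine ⟨1, 1, one_pos, one_pos, fun δ hδ0 hδ1 => ?_⟩
  set L : ℝ := Real.log (1 / δ) with hL
  have hL0 : 0 < L := Real.log_pos (by rw [lt_div_iff₀ hδ0]; linarith)
  -- The exponential makes $\log(2/\delta_1)\ge L/\delta^2$. This is the amount of noise that brings
  -- each view within total variation $\delta/2$ of the reference.
  set δ₁ : ℝ := δ * Real.exp (-(L / δ ^ 2)) with hδ₁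
  have hδ₁0 : 0 < δ₁ := by positivity
  have hδ₁δ : δ₁ ≤ δ :=
    mul_le_of_le_one_right hδ0.le (Real.exp_le_one_iff.2 (neg_nonpos.2 (by positivity)))
  set l : ℝ := Real.log (2 / δ₁) with hl
  have hlL : L / δ ^ 2 ≤ l := by
    rw [hl, Real.log_div two_ne_zero hδ₁0.ne', hδ₁, Real.log_mul hδ0.ne' (Real.exp_pos _).ne',
      Real.log_exp]
    have := Real.log_pos one_lt_two
    have : Real.log δ < 0 := Real.log_neg hδ0 hδ1
    linarith
  have hl0 : 0 < l := lt_of_lt_of_le (by positivity) hlL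
  -- $112=14\cdot2\cdot2\cdot2$ gives $\gamma_j\le1/2$, from $\bar p_j\le2p_j$ and $n-1\ge n/2$. In
  -- $7168=14\cdot4\cdot2\cdot64$, the $4$ bounds $(1-\gamma_j)^{-2}$, the $2$ comes from $n-1\ge
  -- n/2$, and $64$ bounds $\bar p_j^3/q_j^2$. The $8$ pays for the rounding, and the outer $4$
  -- comes from $m\le2\log\log n$.
  refine ⟨112 * (l * L), 4 * (7168 * (l * L) + 8), by positivity, by positivity, ?_⟩
  intro n m _ ε hm hε hεm hεL hK
  obtain ⟨hn1, hn2, hn3⟩ := bounds_of_eq_floor_logb (NeZero.ne m) hm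
  have hm1 : (1 : ℝ) ≤ m := by exact_mod_cast Nat.one_le_iff_ne_zero.2 (NeZero.ne m)
  have hm0 : (0 : ℝ) < m := by linarith
  have hn8 : (2 : ℝ) ≤ n := by
    refine le_trans ?_ hn1
    calc (2 : ℝ) = 2 ^ 1 := by norm_num
      _ ≤ 2 ^ (3 ^ m) := pow_le_pow_right₀ (by norm_num) (Nat.one_le_pow _ _ (by norm_num))
  have hn0 : (0 : ℝ) < n := by linarith
  have hn' : (n : ℝ) / 2 ≤ n - 1 := by linarith
  have hn'0 : (0 : ℝ) < n - 1 := by linarith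
  set p : Fin m → ℕ := fun i => 2 ^ (3 ^ (i.val + 1)) with hp
  have hp0 : ∀ j, 0 < p j := fun j => by positivity
  have hp1 : ∀ j, (1 : ℝ) ≤ p j := fun j => by exact_mod_cast hp0 j
  have hk : ∀ j, (precision p j : ℝ) ≤ 2 * p j := by
    intro j
    have := hp1 j
    rw [precision]
    split_ifs <;> push_cast <;> linarith
  have hk0 : ∀ j, (0 : ℝ) < precision p j := by
    intro j
    have := hp1 j
    rw [precision]
    split_ifs <;> push_cast <;> linarith
  have hpm : ∀ j, (p j : ℝ) ≤ 2 ^ (3 ^ m) := by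
    intro j
    simp only [hp]
    push_cast
    exact pow_le_pow_right₀ (by norm_num) (Nat.pow_le_pow_right (by norm_num) j.2)
  have hq : ∀ j : Fin m, 8 * (q p (j + 1) : ℝ) ^ 2 = (p j : ℝ) ^ 3 := fun j => by
    exact_mod_cast eight_mul_sq_q j
  have hq0 : ∀ j : Fin m, (0 : ℝ) < (q p (j + 1) : ℝ) := fun j => by exact_mod_cast q_pos hp0 j
  set ε₁ : ℝ := ε / Real.sqrt (m * L) with hε₁
  have hε₁sq : ε₁ ^ 2 = ε ^ 2 / (m * L) := by rw [hε₁, div_pow, Real.sq_sqrt (by positivity)]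
  let g : Fin m → ℝ := fun j => 14 * (precision p j : ℝ) * l / (((n : ℝ) - 1) * ε₁ ^ 2)
  have hg : ∀ j, g j = 14 * (l * L) * m * precision p j / ((n - 1) * ε ^ 2) := by
    intro j
    simp only [g, hε₁sq]
    field_simp
  have hg0 : ∀ j, 0 < g j := by
    intro j
    rw [hg]
    have := hk0 j
    positivity
  have hg1 : ∀ j, g j ≤ 1 / 2 := by
    intro j
    rw [hg, div_le_div_iff₀ (by positivity) two_pos, one_mul]
    have h1 : (precision p j : ℝ) ≤ 2 * 2 ^ (3 ^ m) := (hk j).trans (by linarith [hpm j])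
    have h2 := mul_le_mul_of_nonneg_left h1 (by positivity : (0 : ℝ) ≤ 14 * (l * L) * m)
    have h3 := mul_le_mul_of_nonneg_right hn' (sq_nonneg ε)
    linarith
  let γ : Fin m → unitInterval := fun j => ⟨g j, (hg0 j).le, (hg1 j).trans (by norm_num)⟩
  have hγ1 : ∀ j, (γ j : ℝ) < 1 := fun j => (hg1 j).trans_lt (by norm_num)
  refine ⟨fun _ => ε₁, fun _ => δ₁, γ, fun _ => by simp, fun _ => ⟨hδ₁0, hδ₁δ⟩, fun _ => rfl, hγ1,
    recursiveProtocol_isDP p γ hg0 hε.le hδ0.le ?_, ?_⟩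
  · have hsum : ∑ j, (precision p j : ℝ) / (n * γ j) ≤ δ ^ 2 / 56 := by
      have hterm : ∀ j, (precision p j : ℝ) / (n * γ j) ≤ δ ^ 2 / 56 / m := by
        intro j
        have h0 := hk0 j
        have e : (precision p j : ℝ) / (n * γ j) = (n - 1) / n * (ε ^ 2 / (14 * (l * L) * m)) := by
          change (precision p j : ℝ) / (n * g j) = _
          rw [hg]
          field_simp
        rw [e]
        have h1 : ((n : ℝ) - 1) / n ≤ 1 := (div_le_one hn0).2 (by linarith)
        refine (mul_le_of_le_one_left (by positivity) h1).trans ?_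
        rw [div_div, div_le_div_iff₀ (by positivity) (by positivity)]
        -- With $\epsilon\le L/2$ and $L\le l\delta^2$, the bound $\epsilon^2/(14\,lLm)$ is at most
        -- $\delta^2/(56m)$.
        have h2 : (2 * ε) ^ 2 ≤ L ^ 2 := pow_le_pow_left₀ (by positivity) hεL 2
        have h3 : L ≤ l * δ ^ 2 := (div_le_iff₀ (by positivity)).1 hlL
        have h4 := mul_le_mul_of_nonneg_left h3 hL0.le
        have h5 : 4 * ε ^ 2 ≤ L * (l * δ ^ 2) := by linarith
        have h6 := mul_le_mul_of_nonneg_left h5 (by positivity : (0 : ℝ) ≤ 14 * m)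
        linarith
      refine (sum_le_sum fun j _ => hterm j).trans_eq ?_
      rw [sum_const, card_univ, Fintype.card_fin, nsmul_eq_mul, mul_div_cancel₀ _ hm0.ne']
    have hsum0 : 0 ≤ ∑ j, (precision p j : ℝ) / (n * γ j) :=
      sum_nonneg fun j _ => div_nonneg (hk0 j).le (mul_nonneg hn0.le (hg0 j).le)
    have hδsq : δ ^ 2 ≤ 1 := pow_le_one₀ hδ0.le hδ1.le
    refine (exp_sub_one_le hsum0 (by linarith)).trans ?_
    nlinarith
  · refine (recursiveProtocol_mse_le hp0 γ hγ1).trans (ENNReal.ofReal_le_ofReal ?_)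
    have hterm : ∀ j, (γ j : ℝ) * precision p j ^ 2 / (1 - γ j) ^ 2 / (q p (j + 1) : ℝ) ^ 2
        ≤ 7168 * (l * L) * m / (n * ε ^ 2) := by
      intro j
      change g j * precision p j ^ 2 / (1 - g j) ^ 2 / (q p (j + 1) : ℝ) ^ 2 ≤ _
      have h1 : (1 : ℝ) / 4 ≤ (1 - g j) ^ 2 := by nlinarith [hg1 j]
      have h2 : (precision p j : ℝ) ^ 3 ≤ 64 * (q p (j + 1) : ℝ) ^ 2 := by
        have := pow_le_pow_left₀ (hk0 j).le (hk j) 3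
        rw [mul_pow, ← hq j] at this
        linarith
      have hqj := hq0 j
      rw [div_div]
      calc g j * precision p j ^ 2 / ((1 - g j) ^ 2 * (q p (j + 1) : ℝ) ^ 2)
          ≤ g j * precision p j ^ 2 / (1 / 4 * (q p (j + 1) : ℝ) ^ 2) := by
            have := hg0 j
            gcongr
        _ = 56 * (l * L) * m / ((n - 1) * ε ^ 2)
              * ((precision p j : ℝ) ^ 3 / (q p (j + 1) : ℝ) ^ 2) := by
            rw [hg]
            field_simp
            ring
        _ ≤ 56 * (l * L) * m / (n / 2 * ε ^ 2) * 64 := by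
            have : (precision p j : ℝ) ^ 3 / (q p (j + 1) : ℝ) ^ 2 ≤ 64 :=
              (div_le_iff₀ (by positivity)).2 h2
            have := hk0 j
            gcongr
        _ = 7168 * (l * L) * m / (n * ε ^ 2) := by
            field_simp
            ring
    have hsum := sum_le_sum fun j (_ : j ∈ univ) => hterm j
    rw [sum_const, card_univ, Fintype.card_fin, nsmul_eq_mul] at hsum
    -- Here $8q_m^2=p_m^3=2^{3^{m+1}}>n$, the upper bound that the floor defining `m` provides.
    have hlast : (n : ℝ) * (1 / (q p m : ℝ) ^ 2) ≤ 8 := by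
      obtain ⟨j, hj⟩ : ∃ j : Fin m, j.val + 1 = m :=
        ⟨⟨m - 1, Nat.sub_one_lt (NeZero.ne m)⟩, Nat.sub_add_cancel (NeZero.one_le)⟩
      have h := hq j
      have h0 := hq0 j
      rw [hj] at h h0
      rw [mul_one_div, div_le_iff₀ (by positivity), h]
      refine hn2.le.trans_eq ?_
      simp only [hp, hj]
      push_cast
      rw [← pow_mul, pow_succ]
    -- The assumption $\epsilon\le m$ lets the constant rounding error be absorbed into
    -- $m^2/\epsilon^2$.
    have hmε : (1 : ℝ) ≤ m ^ 2 / ε ^ 2 := by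
      rw [one_le_div (by positivity)]
      exact pow_le_pow_left₀ hε.le hεm 2
    have hloglog : (m : ℝ) ^ 2 ≤ 4 * Real.log (Real.log n) ^ 2 := by nlinarith
    calc (n : ℝ) * (∑ j, (γ j : ℝ) * precision p j ^ 2 / (1 - γ j) ^ 2 / (q p (j + 1) : ℝ) ^ 2
          + 1 / (q p m : ℝ) ^ 2)
        ≤ n * (m * (7168 * (l * L) * m / (n * ε ^ 2))) + 8 := by
          rw [mul_add]
          exact add_le_add (mul_le_mul_of_nonneg_left hsum hn0.le) hlast
      _ = 7168 * (l * L) * (m ^ 2 / ε ^ 2) + 8 := by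
          field_simp
      _ ≤ (7168 * (l * L) + 8) * (m ^ 2 / ε ^ 2) := by linarith
      _ ≤ (7168 * (l * L) + 8) * (4 * Real.log (Real.log n) ^ 2 / ε ^ 2) := by gcongr
      _ = 4 * (7168 * (l * L) + 8) * Real.log (Real.log n) ^ 2 / ε ^ 2 := by ring
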